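/- Let $(M,\mu)$ be a probability space and let $f\colon M\to M$ be an invertible (bijective and bimeasurable), ergodic, measure-preserving transformation. Let $\mathcal W$ be a partition of $M$ into measurable sets which is countable or, more generally, has the property that for every measurable $A\subset M$ the union of the elements of $\mathcal W$ that meet $A$ agrees, up to a $\mu$-null set, with a measurable union of elements of $\mathcal W$. (Every countable partition into measurable sets has this property; so does, on a standard Borel probability space, the partition into the fibres of a Borel map to a standard Borel space, for example a measurable partition into local stable leaves.) Let $\mathcal F_0$ be the $\sigma$-algebra of all measurable sets that are unions of elements of $\mathcal W$; for countable $\mathcal W$ this is the $\sigma$-algebra generated by $\mathcal W$. Assume that $f^{-1}\mathcal F_0\subset\mathcal F_0$. Consider rates $r(n)$ of one of the following two types. - Stretched exponential: $r(n)=e^{-\tau n^\omega}$ with constants $\tau>0$ and $0<\omega\le 1$; in this case put $r'(\varepsilon,n)=\exp\{-\tau'\varepsilon^{\omega}n^{\omega/2}\}$, where $\tau'>0$ is a sufficiently small constant that does not depend on $\varepsilon$ and $n$. - Polynomial: $r(n)=n^{-\beta}$ with a constant $\beta>0$; in this case fix any $p>\max\{2,2\beta\}$ and put $r'(\varepsilon,n)=\varepsilon^{-p}n^{-\beta}$.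 Let $\varphi\colon M\to\mathbb R$ be a measurable, essentially bounded function with $\int\varphi\,d\mu=0$. For $x\in M$ let $(f^n\mathcal W)(x)$ be the element of the partition $f^n\mathcal W=\{f^n(W):W\in\mathcal W\}$ that contains $x$. Suppose that there is a constant $C>0$ such that (i) $\left|\int\varphi\,(\psi\circ f^n)\,d\mu-\int\varphi\,d\mu\int\psi\,d\mu\right|\le C\|\psi\|_\infty\, r(n)$ for all essentially bounded $\mathcal F_0$-measurable $\psi\colon M\to\mathbb R$ and all $n\ge 1$; (ii) $\int \operatorname{diam}\varphi\big((f^n\mathcal W)(x)\big)\,d\mu(x)\le C\,r(n)$ for all $n\ge 1$; if $\mathcal W$ is countable, the left-hand side is $\sum_{W\in f^n\mathcal W}\mu(W)\operatorname{diam}\varphi(W)$. Then (for some such $\tau'>0$ in the stretched exponential case) there is a constant $C'>0$ such that $$\mu\left(\sup_{k\ge n}\left|\frac1k\sum_{j=0}^{k-1}\varphi\circ f^j-\int\varphi\,d\mu\right|>\varepsilon\right)\le C'\,r'(\varepsilon,n)\qquad\text{for all } n\ge 1,\ \varepsilon>0 .$$ -/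

import Mathlib

open MeasureTheory Set Filter
open scoped ENNReal

namespace MaxLargeDev

variable {M : Type*}

/-- The cell of the partition `𝒱` that contains `x`. -/
def cell (𝒱 : Set (Set M)) (x : M) : Set M := ⋃₀ {W ∈ 𝒱 | x ∈ W}

/-- The union of all cells of `𝒱` that meet `A`. -/
def saturation (𝒱 : Set (Set M)) (A : Set M) : Set M := ⋃₀ {W ∈ 𝒱 | (W ∩ A).Nonempty}

/-- The σ-algebra of a partition `𝒱`: the measurable sets that are unions of cells, so that a
measurable function is measurable for it exactly if it is constant on every cell. For a countable
partition into measurable sets this is the σ-algebra generated by `𝒱`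
(`cellAlgebra_eq_generateFrom`). -/
@[reducible] def cellAlgebra [MeasurableSpace M] (𝒱 : Set (Set M)) : MeasurableSpace M where
  MeasurableSet' A := MeasurableSet A ∧ ∀ W ∈ 𝒱, (W ∩ A).Nonempty → W ⊆ A
  measurableSet_empty := ⟨MeasurableSet.empty, by simp⟩
  measurableSet_compl A hA := by
    refine ⟨hA.1.compl, ?_⟩
    rintro W hW ⟨x, hxW, hxA⟩ y hyW hyA
    exact hxA (hA.2 W hW ⟨y, hyW, hyA⟩ hxW)
  measurableSet_iUnion A hA := by
    refine ⟨MeasurableSet.iUnion fun i => (hA i).1, ?_⟩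
    rintro W hW ⟨x, hxW, hxA⟩
    obtain ⟨i, hi⟩ := mem_iUnion.1 hxA
    exact ((hA i).2 W hW ⟨x, hxW, hi⟩).trans (subset_iUnion A i)

/-- `𝒱` is a partition of the measure space into measurable sets such that the union of the cells
that meet a given measurable set is, up to a null set, a measurable union of cells. Every countable
partition into measurable sets is of this kind (`isMeasurablePartition_of_countable`), and so is
the partition of a standard Borel probability space into the fibres of a Borel map to another such
space (the measurable partitions of Rokhlin, for instance into local stable leaves), by the
universal measurability of analytic sets. -/
structure IsMeasurablePartition [MeasurableSpace M] (μ : Measure M) (𝒱 : Set (Set M)) :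
    Prop where
  isPartition : Setoid.IsPartition 𝒱
  measurableSet : ∀ W ∈ 𝒱, MeasurableSet W
  saturation_ae : ∀ A, MeasurableSet A →
    ∃ B, MeasurableSet[cellAlgebra 𝒱] B ∧ saturation 𝒱 A =ᵐ[μ] B

/-- The partition `fⁿ𝒲 = {fⁿ(W) : W ∈ 𝒲}`. -/
def iterPartition (f : M → M) (n : ℕ) (𝒲 : Set (Set M)) : Set (Set M) :=
  (fun W => f^[n] '' W) '' 𝒲

/-- The average over `μ` of the diameter of `φ(W)`, where `W` runs through the cells of `𝒱`:
for a countable partition it is the sum of the `μ(W) diam φ(W)` over the cells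
(`avgDiam_eq_tsum`). -/
noncomputable def avgDiam [MeasurableSpace M] (μ : Measure M) (φ : M → ℝ) (𝒱 : Set (Set M)) :
    ℝ≥0∞ :=
  ∫⁻ x, Metric.ediam (φ '' cell 𝒱 x) ∂μ

/-- The correlation function `ρ_{φ,ψ}(n)`. -/
noncomputable def corr [MeasurableSpace M] (μ : Measure M) (f : M → M) (φ ψ : M → ℝ) (n : ℕ) : ℝ :=
  |∫ x, φ x * ψ (f^[n] x) ∂μ - (∫ x, φ x ∂μ) * ∫ x, ψ x ∂μ|

/-- `MLD(φ,ε,n) = μ(sup_{k ≥ n} |(1/k) ∑_{j<k} φ ∘ f^j - ∫ φ dμ| > ε)`. -/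
noncomputable def MLD [MeasurableSpace M] (μ : Measure M) (f : M → M) (φ : M → ℝ) (ε : ℝ)
    (n : ℕ) : ℝ :=
  μ.real {x | ENNReal.ofReal ε <
    ⨆ k : ℕ, ⨆ _ : n ≤ k, ENNReal.ofReal |birkhoffAverage ℝ f φ k x - ∫ y, φ y ∂μ|}

/-- Correlations of `φ` against the bounded observables that are measurable for the σ-algebra of
`𝒲` decay at rate `r`, with constant `C`. -/
def CorrDecay [MeasurableSpace M] (μ : Measure M) (f : M → M) (𝒲 : Set (Set M)) (φ : M → ℝ)
    (C : ℝ) (r : ℕ → ℝ) : Prop :=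
  ∀ ψ : M → ℝ, Measurable[cellAlgebra 𝒲] ψ → MemLp ψ ∞ μ → ∀ n : ℕ, 1 ≤ n →
    corr μ f φ ψ n ≤ C * (eLpNorm ψ ∞ μ).toReal * r n

/-- The cells of `fⁿ𝒲` have, on average, images of diameter at most `C r(n)` under `φ`. -/
def CellDecay [MeasurableSpace M] (μ : Measure M) (f : M → M) (𝒲 : Set (Set M)) (φ : M → ℝ)
    (C : ℝ) (r : ℕ → ℝ) : Prop :=
  ∀ n : ℕ, 1 ≤ n → avgDiam μ φ (iterPartition f n 𝒲) ≤ ENNReal.ofReal (C * r n)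

/-! The following facts show that for a countable partition the notions above are the elementary
ones. -/

lemma cell_eq {𝒱 : Set (Set M)} (h : Setoid.IsPartition 𝒱) {W : Set M} (hW : W ∈ 𝒱) {x : M}
    (hx : x ∈ W) : cell 𝒱 x = W := by
  ext y
  simp only [cell, mem_sUnion, mem_ofPred_eq]
  constructor
  · rintro ⟨V, ⟨hV, hxV⟩, hy⟩
    have : V = W := (h.2 x).unique ⟨hV, hxV⟩ ⟨hW, hx⟩
    exact this ▸ hy
  · exact fun hy => ⟨W, ⟨hW, hx⟩, hy⟩

lemma cellAlgebra_eq_generateFrom [MeasurableSpace M] {𝒱 : Set (Set M)}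
    (h : Setoid.IsPartition 𝒱) (hm : ∀ W ∈ 𝒱, MeasurableSet W) (hc : 𝒱.Countable) :
    cellAlgebra 𝒱 = MeasurableSpace.generateFrom 𝒱 := by
  apply le_antisymm
  · intro A hA
    have hA' : A = ⋃₀ {W ∈ 𝒱 | W ⊆ A} := by
      ext x
      simp only [mem_sUnion, mem_ofPred_eq]
      constructor
      · intro hx
        obtain ⟨W, hW, -⟩ := h.2 x
        exact ⟨W, ⟨hW.1, hA.2 W hW.1 ⟨x, hW.2, hx⟩⟩, hW.2⟩
      · rintro ⟨W, ⟨-, hWA⟩, hx⟩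
        exact hWA hx
    rw [hA']
    exact MeasurableSet.sUnion (hc.mono fun W hW => hW.1)
      fun W hW => MeasurableSpace.measurableSet_generateFrom hW.1
  · apply MeasurableSpace.generateFrom_le
    intro W hW
    refine ⟨hm W hW, ?_⟩
    rintro V hV ⟨x, hxV, hxW⟩
    rw [(h.2 x).unique ⟨hV, hxV⟩ ⟨hW, hxW⟩]

lemma isMeasurablePartition_of_countable [MeasurableSpace M] (μ : Measure M) {𝒱 : Set (Set M)}
    (h : Setoid.IsPartition 𝒱) (hm : ∀ W ∈ 𝒱, MeasurableSet W) (hc : 𝒱.Countable) :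
    IsMeasurablePartition μ 𝒱 where
  isPartition := h
  measurableSet := hm
  saturation_ae A _ := by
    refine ⟨saturation 𝒱 A, ⟨MeasurableSet.sUnion (hc.mono fun W hW => hW.1)
      fun W hW => hm W hW.1, ?_⟩, Filter.EventuallyEq.rfl⟩
    rintro W hW ⟨x, hxW, V, ⟨hV, hVA⟩, hxV⟩ y hy
    have : V = W := (h.2 x).unique ⟨hV, hxV⟩ ⟨hW, hxW⟩
    exact ⟨W, ⟨hW, this ▸ hVA⟩, hy⟩

lemma avgDiam_eq_tsum [MeasurableSpace M] (μ : Measure M) (φ : M → ℝ) {𝒱 : Set (Set M)}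
    (h : Setoid.IsPartition 𝒱) (hm : ∀ W ∈ 𝒱, MeasurableSet W) (hc : 𝒱.Countable) :
    avgDiam μ φ 𝒱 = ∑' W : 𝒱, μ (W : Set M) * Metric.ediam (φ '' (W : Set M)) := by
  have hU : ⋃ W ∈ 𝒱, W = univ := by rw [← sUnion_eq_biUnion, h.sUnion_eq_univ]
  rw [avgDiam, ← setLIntegral_univ, ← hU,
    lintegral_biUnion hc hm h.pairwiseDisjoint]
  refine tsum_congr fun W => ?_
  rw [setLIntegral_congr_fun (g := fun _ => Metric.ediam (φ '' (W : Set M))) (hm W W.2)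
    (fun x hx => by simp only [cell_eq h W.2 hx]), setLIntegral_const, mul_comm]

lemma iterPartition_spec [MeasurableSpace M] (f : M ≃ᵐ M) (n : ℕ) {𝒲 : Set (Set M)}
    (h : Setoid.IsPartition 𝒲) (hm : ∀ W ∈ 𝒲, MeasurableSet W) :
    Setoid.IsPartition (iterPartition f n 𝒲) ∧
      ∀ W ∈ iterPartition f n 𝒲, MeasurableSet W := by
  have hb : Function.Bijective (⇑f)^[n] := f.bijective.iterate n
  refine ⟨⟨?_, fun a => ?_⟩, ?_⟩
  · rintro ⟨W, hW, hW0⟩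
    exact h.1 (image_eq_empty.1 hW0 ▸ hW)
  · obtain ⟨b, rfl⟩ := hb.2 a
    obtain ⟨W, hW, hu⟩ := h.2 b
    refine ⟨_, ⟨⟨W, hW.1, rfl⟩, mem_image_of_mem _ hW.2⟩, ?_⟩
    rintro _ ⟨⟨V, hV, rfl⟩, hbV⟩
    have := hu V ⟨hV, (hb.1.mem_set_image).1 hbV⟩
    simp only [this]
  · rintro _ ⟨W, hW, rfl⟩
    have key : ∀ k : ℕ, MeasurableSet ((⇑f)^[k] '' W) := by
      intro k
      induction k with
      | zero => simpa using hm W hW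
      | succ k ih =>
        rw [Function.iterate_succ', image_comp]
        exact (MeasurableEquiv.measurableSet_image f).2 ih
    exact key n

/-- For a countable partition `𝒲` into measurable sets, `CellDecay` bounds the sum
`∑_{W ∈ fⁿ𝒲} μ(W) diam φ(W)`. -/
lemma cellDecay_iff_of_countable [MeasurableSpace M] (μ : Measure M) (f : M ≃ᵐ M) (φ : M → ℝ)
    {𝒲 : Set (Set M)} (h : Setoid.IsPartition 𝒲) (hm : ∀ W ∈ 𝒲, MeasurableSet W)
    (hc : 𝒲.Countable) (C : ℝ) (r : ℕ → ℝ) :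
    CellDecay μ f 𝒲 φ C r ↔ ∀ n : ℕ, 1 ≤ n →
      ∑' W : iterPartition f n 𝒲, μ (W : Set M) * Metric.ediam (φ '' (W : Set M))
        ≤ ENNReal.ofReal (C * r n) := by
  refine forall_congr' fun n => forall_congr' fun _ => ?_
  obtain ⟨h1, h2⟩ := iterPartition_spec f n h hm
  rw [avgDiam_eq_tsum μ φ h1 h2 (hc.image _)]

end MaxLargeDev

namespace MaxLargeDev

variable {M : Type*}

/-! Write `F_k` for the σ-algebra f⁻ᵏF₀, which decreases in k, and η_k = E[φ | F_k]. Hypothesis (i)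
says by duality that ‖η_n‖₁ ≤ C r(n) (`eLpNorm_condExp_le_of_corrDecay`). Hypothesis (ii) gives ‖φ -
η_{-n}‖₁ ≤ 2C r(n) (`eLpNorm_sub_condExp_le_of_cellDecay`). As φ is bounded, interpolation turns
both into Lᵖ bounds of order r(n)^{1/p}, with a constant that does not depend on p.

Telescope φ dyadically: the blocks η_a - η_b with b - a = 2ˢ, plus the two remainders η_{2^S} and φ
- η_{-2^S}. A block is F_a-measurable with vanishing conditional expectation given F_b, hence a
reversed martingale difference for f^{2ˢ}. The Burkholder-type bound `lpNorm_birkhoffSum_sq_le`,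
applied along each residue class mod 2ˢ, costs only a factor √p · √2ˢ. This gives, uniformly in p >
2, m and S (`exists_moment_bound`), ‖S_{2^m} φ‖_p ≤ D (2^m r(2^S)^{1/p} + √p √2^m (1 + ∑_{s<S} √2ˢ
r(2ˢ)^{1/p})).

For polynomial rates take S = m; since p > 2β the sum is dominated by its last term and the bound is
of order 2^{m(1-β/p)}. For stretched exponential rates let S be large; the sum is of order
p^{1/(2ω)}, and ω ≤ 1 gives the bound A p^{1/ω} √2^m.

A dyadic maximal function passes from S_{2^m} to max_{k ≤ 2^m} |S_k| without changing the order
(`lpNorm_dyadicMax_le`). Markov's inequality and a union over dyadic ranges of k finish the proof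
(`MLD_le_tsum`). For stretched exponential rates p is optimised on each range, p ~ (ε√k)^ω. -/

/-! ### Convexity inequalities for `|·|ᵖ` and the moment recursion -/

lemma rpow_sub_rpow_le {x y q : ℝ} (hx : 0 ≤ x) (hy : 0 ≤ y) (hq : 1 < q) :
    y ^ q - x ^ q ≤ q * y ^ (q - 1) * (y - x) := by
  rcases hy.eq_or_lt with rfl | hy
  · rw [Real.zero_rpow (by linarith), Real.zero_rpow (by linarith)]
    have := Real.rpow_nonneg hx q
    linarith
  -- The tangent line of t ↦ t^q at y, as Bernoulli's inequality for x / y.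
  · have h := one_add_mul_self_le_rpow_one_add (s := x / y - 1)
      (by have := div_nonneg hx hy.le; linarith) hq.le
    rw [add_sub_cancel, Real.div_rpow hx hy.le, le_div_iff₀ (Real.rpow_pos_of_pos hy q)] at h
    have e : y ^ q = y ^ (q - 1) * y := by
      rw [← Real.rpow_add_one hy.ne']; ring_nf
    have : (1 + q * (x / y - 1)) * y ^ q = y ^ q + q * y ^ (q - 1) * (x - y) := by
      rw [e]; field_simp
    linarith

lemma abs_rpow_eq {p : ℝ} (hp : 2 < p) (x : ℝ) : |x| ^ p = |x| ^ (p - 2) * x ^ 2 := by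
  rw [← sq_abs x, ← Real.rpow_natCast, ← Real.rpow_add_of_nonneg (abs_nonneg x) (by linarith)
    (by norm_num)]
  norm_num

lemma abs_rpow_sub_le {p : ℝ} (hp : 2 < p) (x y : ℝ) :
    |y| ^ p - |x| ^ p ≤ p * (|y| ^ (p - 2) * y) * (y - x) := by
  have h := rpow_sub_rpow_le (abs_nonneg x) (abs_nonneg y) (q := p) (by linarith)
  have e : |y| ^ (p - 1) = |y| ^ (p - 2) * |y| := by
    nth_rw 3 [← Real.rpow_one |y|]
    rw [← Real.rpow_add_of_nonneg (abs_nonneg y) (by linarith) (by norm_num)]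
    ring_nf
  have h1 : |y| * |x| ≥ y * x := by rw [← abs_mul]; exact le_abs_self _
  have h2 : |y| * |y| = y * y := abs_mul_abs_self y
  have h3 : 0 ≤ p * |y| ^ (p - 2) := by positivity
  rw [e] at h
  nlinarith [mul_le_mul_of_nonneg_left h1 h3]

/-- The function |t|^(p-2) t has derivative (p-1)|t|^(p-2), which on an interval is at most its
value at one of the endpoints; the sum of both values avoids asking which. Arguments of opposite
sign are compared directly. -/
lemma rpow_mul_self_sub_mul_le {p : ℝ} (hp : 2 < p) (x y : ℝ) :
    (|y| ^ (p - 2) * y - |x| ^ (p - 2) * x) * (y - x) ≤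
      (p - 1) * (|x| ^ (p - 2) + |y| ^ (p - 2)) * (y - x) ^ 2 := by
  have key : ∀ a b : ℝ, 0 ≤ a → a ≤ b → b ^ (p - 2) * b - a ^ (p - 2) * a ≤
      (p - 1) * (a ^ (p - 2) + b ^ (p - 2)) * (b - a) := by
    intro a b ha hab
    have h := rpow_sub_rpow_le ha (ha.trans hab) (q := p - 1) (by linarith)
    have e : ∀ c : ℝ, 0 ≤ c → c ^ (p - 1) = c ^ (p - 2) * c := by
      intro c hc
      nth_rw 3 [← Real.rpow_one c]
      rw [← Real.rpow_add_of_nonneg hc (by linarith) (by norm_num)]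
      ring_nf
    rw [e a ha, e b (ha.trans hab), show p - 1 - 1 = p - 2 by ring] at h
    have : 0 ≤ (p - 1) * a ^ (p - 2) * (b - a) :=
      mul_nonneg (mul_nonneg (by linarith) (Real.rpow_nonneg ha _)) (by linarith)
    linarith
  have main : ∀ x y : ℝ, x ≤ y → |y| ^ (p - 2) * y - |x| ^ (p - 2) * x ≤
      (p - 1) * (|x| ^ (p - 2) + |y| ^ (p - 2)) * (y - x) := by
    intro x y hxy
    rcases le_total 0 x with hx | hx
    · rw [abs_of_nonneg hx, abs_of_nonneg (hx.trans hxy)]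
      exact key x y hx hxy
    · rcases le_total 0 y with hy | hy
      · have hα : 0 ≤ |y| ^ (p - 2) := by positivity
        have hβ : 0 ≤ |x| ^ (p - 2) := by positivity
        nlinarith [mul_nonneg hα hy, mul_nonneg hβ hy, mul_nonneg hα (neg_nonneg.2 hx),
          mul_nonneg hβ (neg_nonneg.2 hx),
          mul_nonneg (by linarith : 0 ≤ p - 2) (mul_nonneg (add_nonneg hα hβ) (sub_nonneg.2 hxy))]
      · have := key (-y) (-x) (by linarith) (by linarith)
        rw [abs_of_nonpos hx, abs_of_nonpos hy]
        linarith
  rcases le_total x y with h | h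
  · have := mul_le_mul_of_nonneg_right (main x y h) (sub_nonneg.2 h)
    linarith
  · have := mul_le_mul_of_nonneg_right (main y x h) (sub_nonneg.2 h)
    linarith

/-- A second order Taylor estimate for `|·|ᵖ`. -/
lemma abs_rpow_le_taylor {p : ℝ} (hp : 2 < p) (x y : ℝ) :
    |x + y| ^ p ≤ |x| ^ p + p * (|x| ^ (p - 2) * x * y) +
      p ^ 2 * (|x| ^ (p - 2) * y ^ 2 + |x + y| ^ (p - 2) * y ^ 2) := by
  have h1 := abs_rpow_sub_le hp x (x + y)
  have h2 := rpow_mul_self_sub_mul_le hp x (x + y)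
  rw [add_sub_cancel_left] at h1 h2
  have h3 : 0 ≤ p * ((|x| ^ (p - 2) + |x + y| ^ (p - 2)) * y ^ 2) := by positivity
  nlinarith [mul_le_mul_of_nonneg_left h2 (by linarith : 0 ≤ p)]

/-- One step of the induction that turns the moment recursion into a square root bound. -/
lemma sq_le_of_moment_recursion {p a b d : ℝ} {k : ℕ} (hp : 2 < p) (ha : 0 ≤ a) (hb : 0 ≤ b)
    (hab : b ^ p ≤ a ^ p + p ^ 2 * (a ^ (p - 2) * d ^ 2 + b ^ (p - 2) * d ^ 2))
    (hak : a ^ 2 ≤ 6 * p * k * d ^ 2) (hbk : b ≤ (k + 1) * d) :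
    b ^ 2 ≤ 6 * p * (k + 1) * d ^ 2 := by
  have hk0 : (0 : ℝ) ≤ k := k.cast_nonneg
  by_cases hkp : (k : ℝ) ≤ p
  -- For k ≤ p the triangle inequality suffices, because k + 1 ≤ 6p.
  · have : b ^ 2 ≤ ((k + 1) * d) ^ 2 := pow_le_pow_left₀ hb hbk 2
    have h2 : ((k : ℝ) + 1) * ((k + 1) * d ^ 2) ≤ (6 * p) * ((k + 1) * d ^ 2) :=
      mul_le_mul_of_nonneg_right (by linarith) (by positivity)
    nlinarith
  push Not at hkp
  by_contra! hlt
  have hk : (0 : ℝ) < k := by linarith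
  have hb0 : 0 < b := by
    rcases hb.eq_or_lt with rfl | h
    · exfalso
      have : 0 ≤ 6 * p * (k + 1) * d ^ 2 := by positivity
      norm_num at hlt; linarith
    · exact h
  -- If the bound fails, b²/a² is at least (k+1)/k. By Bernoulli aᵖ is then smaller than bᵖ by a
  -- definite factor k/(k+q), and the recursion can be divided by b^(p-2).
  have hab2 : a ^ 2 * (k + 1) ≤ b ^ 2 * k := by nlinarith
  have hle : a ≤ b := by
    refine (pow_le_pow_iff_left₀ ha hb two_ne_zero).1 ?_
    nlinarith
  set q := p / 2 with hq
  have hP : ∀ c : ℝ, 0 ≤ c → c ^ p = (c ^ 2) ^ q := by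
    intro c hc
    rw [← Real.rpow_natCast, ← Real.rpow_mul hc, hq]; congr 1; push_cast; ring
  have hbern : (1 + q / k) ≤ ((k + 1) / k : ℝ) ^ q := by
    have := one_add_mul_self_le_rpow_one_add (s := 1 / (k : ℝ)) (p := q)
      (by have : (0 : ℝ) ≤ 1 / k := by positivity
          linarith) (by linarith)
    convert this using 1
    · ring
    · congr 1; field_simp
  have hap : a ^ p * (1 + q / k) ≤ b ^ p := by
    calc a ^ p * (1 + q / k) ≤ (a ^ 2) ^ q * ((k + 1) / k : ℝ) ^ q := by
          rw [hP a ha]; gcongr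
      _ = (a ^ 2 * ((k + 1) / k)) ^ q := by
          rw [Real.mul_rpow (by positivity) (by positivity)]
      _ ≤ (b ^ 2) ^ q := by
          apply Real.rpow_le_rpow (by positivity) _ (by linarith)
          rw [mul_div_assoc', div_le_iff₀ hk]; exact hab2
      _ = b ^ p := (hP b hb).symm
  have hbp : b ^ p = b ^ (p - 2) * b ^ 2 := by
    rw [← abs_of_nonneg hb]; simpa using abs_rpow_eq hp b
  have hap2 : a ^ (p - 2) ≤ b ^ (p - 2) := Real.rpow_le_rpow ha hle (by linarith)
  have hB : 0 < b ^ (p - 2) := Real.rpow_pos_of_pos hb0 _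
  have h1 : a ^ p ≤ b ^ p * (k / (k + q)) := by
    have h0 : 1 + q / k = (k + q) / k := by field_simp
    rw [h0] at hap
    have : (0 : ℝ) < k + q := by linarith
    rw [mul_div_assoc', le_div_iff₀ this]
    rw [mul_div_assoc', div_le_iff₀ hk] at hap
    exact hap
  have h2 : b ^ 2 ≤ b ^ 2 * (k / (k + q)) + 2 * p ^ 2 * d ^ 2 := by
    have h3 : b ^ (p - 2) * b ^ 2 ≤
        b ^ (p - 2) * (b ^ 2 * (k / (k + q)) + 2 * p ^ 2 * d ^ 2) := by
      calc b ^ (p - 2) * b ^ 2 = b ^ p := hbp.symm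
        _ ≤ b ^ p * (k / (k + q)) + p ^ 2 * (b ^ (p - 2) * d ^ 2 + b ^ (p - 2) * d ^ 2) := by
          refine hab.trans (add_le_add h1 ?_)
          gcongr
        _ = _ := by rw [hbp]; ring
    exact le_of_mul_le_mul_left h3 hB
  have hkq : (0 : ℝ) < k + q := by linarith
  have h4 : b ^ 2 * (k + q) ≤ b ^ 2 * k + 2 * p ^ 2 * d ^ 2 * (k + q) := by
    have := mul_le_mul_of_nonneg_right h2 hkq.le
    have e : (b ^ 2 * (k / (k + q)) + 2 * p ^ 2 * d ^ 2) * (k + q) =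
      b ^ 2 * k + 2 * p ^ 2 * d ^ 2 * (k + q) := by field_simp
    linarith
  have hpq : p = 2 * q := by rw [hq]; ring
  have h5 : b ^ 2 * q ≤ (4 * p * d ^ 2 * (k + q)) * q := by
    have : 2 * p ^ 2 * d ^ 2 * (k + q) = (4 * p * d ^ 2 * (k + q)) * q := by
      rw [hpq]; ring
    linarith
  have h6 : b ^ 2 ≤ 4 * p * d ^ 2 * (k + q) := le_of_mul_le_mul_right h5 (by linarith)
  -- Here q = p/2 < k/2, so k + q ≤ 3(k+1)/2; this is the origin of the constant 6.
  have h7 : 4 * p * d ^ 2 * (k + q) ≤ 4 * p * d ^ 2 * (3 / 2 * (k + 1)) := by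
    gcongr; linarith
  linarith

/-! ### Integrals and Lᵖ norms of bounded functions -/

lemma memLp_top_continuous_comp [MeasurableSpace M] {μ : Measure M} [IsFiniteMeasure μ]
    {g : M → ℝ} (hg : MemLp g ∞ μ) {h : ℝ → ℝ} (hh : Continuous h) :
    MemLp (fun x => h (g x)) ∞ μ := by
  obtain ⟨C, hC⟩ := isCompact_Icc (a := -lpNorm g ∞ μ) (b := lpNorm g ∞ μ)
    |>.exists_bound_of_continuousOn hh.continuousOn
  refine memLp_top_of_bound (hh.comp_aestronglyMeasurable hg.1) C ?_
  filter_upwards [ae_le_lpNorm_exponent_top hg] with x hx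
  exact hC _ (abs_le.1 hx)

lemma integrable_of_memLp_top [MeasurableSpace M] {μ : Measure M} [IsFiniteMeasure μ]
    {g : M → ℝ} (hg : MemLp g ∞ μ) : Integrable g μ :=
  hg.integrable le_top

lemma memLp_top_mul [MeasurableSpace M] {μ : Measure M} {g h : M → ℝ} (hg : MemLp g ∞ μ)
    (hh : MemLp h ∞ μ) : MemLp (fun x => g x * h x) ∞ μ :=
  MemLp.mul' (p := ∞) (q := ∞) hh hg

lemma lpNorm_rpow [MeasurableSpace M] {μ : Measure M} {g : M → ℝ} (hg : AEStronglyMeasurable g μ)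
    {p : ℝ} (hp : 0 < p) :
    lpNorm g (ENNReal.ofReal p) μ ^ p = ∫ x, |g x| ^ p ∂μ := by
  rw [lpNorm_eq_integral_norm_rpow_toReal (by simpa) (by simp) hg, ENNReal.toReal_ofReal hp.le,
    Real.rpow_inv_rpow (integral_nonneg fun x => by positivity) hp.ne']
  rfl

lemma lpNorm_comp [MeasurableSpace M] {μ : Measure M} {T : M → M} (hT : MeasurePreserving T μ μ)
    {g : M → ℝ} (hg : AEStronglyMeasurable g μ) (p : ℝ≥0∞) :
    lpNorm (g ∘ T) p μ = lpNorm g p μ := by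
  rw [← toReal_eLpNorm hg, ← toReal_eLpNorm (hg.comp_measurePreserving hT),
    eLpNorm_comp_measurePreserving hg hT]

lemma integral_rpow_mul_sq_le [MeasurableSpace M] {μ : Measure M} [IsProbabilityMeasure μ]
    {g d : M → ℝ} (hg : MemLp g ∞ μ) (hd : MemLp d ∞ μ) {p : ℝ} (hp : 2 < p) :
    ∫ x, |g x| ^ (p - 2) * d x ^ 2 ∂μ ≤
      lpNorm g (ENNReal.ofReal p) μ ^ (p - 2) * lpNorm d (ENNReal.ofReal p) μ ^ 2 := by
  have hp0 : 0 < p := by linarith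
  -- Hölder with exponents p/(p-2) and p/2 makes both factors powers of Lᵖ norms.
  have hpq : (p / (p - 2)).HolderConjugate (p / 2) := by
    rw [Real.holderConjugate_iff]
    refine ⟨by rw [lt_div_iff₀ (by linarith)]; linarith, ?_⟩
    have : p - 2 ≠ 0 := by linarith
    field_simp; ring
  have c1 : Continuous fun t : ℝ => |t| ^ (p - 2) :=
    continuous_abs.rpow_const fun _ => Or.inr (by linarith)
  have h := integral_mul_le_Lp_mul_Lq_of_nonneg hpq (μ := μ) (f := fun x => |g x| ^ (p - 2))
    (g := fun x => d x ^ 2) (ae_of_all _ fun x => by positivity)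
    (ae_of_all _ fun x => by positivity)
    ((memLp_top_continuous_comp hg c1).mono_exponent le_top)
    ((memLp_top_continuous_comp hd (continuous_pow 2)).mono_exponent le_top)
  refine h.trans (le_of_eq ?_)
  have e1 : ∀ x, (|g x| ^ (p - 2)) ^ (p / (p - 2)) = |g x| ^ p := by
    intro x
    rw [← Real.rpow_mul (abs_nonneg _)]
    congr 1; have : p - 2 ≠ 0 := by linarith
    field_simp
  have e2 : ∀ x, (d x ^ 2) ^ (p / 2) = |d x| ^ p := by
    intro x
    rw [← sq_abs, ← Real.rpow_natCast, ← Real.rpow_mul (abs_nonneg _)]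
    congr 1; push_cast; ring
  simp only [e1, e2]
  rw [← lpNorm_rpow hg.1 hp0, ← lpNorm_rpow hd.1 hp0, ← Real.rpow_mul lpNorm_nonneg,
    ← Real.rpow_mul lpNorm_nonneg, ← Real.rpow_natCast]
  have h1 : p * (1 / (p / (p - 2))) = p - 2 := by field_simp
  have h2 : p * (1 / (p / 2)) = (2 : ℕ) := by push_cast; field_simp
  rw [h1, h2]

/-! ### Moments of Birkhoff sums of reversed martingale differences -/

lemma memLp_birkhoffSum [MeasurableSpace M] {μ : Measure M} {T : M → M}
    (hT : MeasurePreserving T μ μ) {g : M → ℝ} {q : ℝ≥0∞} (hg : MemLp g q μ) (n : ℕ) :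
    MemLp (birkhoffSum T g n) q μ := by
  have : birkhoffSum T g n = ∑ k ∈ Finset.range n, g ∘ T^[k] := by
    ext x; simp [birkhoffSum]
  rw [this]
  exact memLp_finsetSum' _ fun k _ => hg.comp_measurePreserving (hT.iterate k)

lemma lpNorm_birkhoffSum_le [MeasurableSpace M] {μ : Measure M} {T : M → M}
    (hT : MeasurePreserving T μ μ) {g : M → ℝ} {q : ℝ≥0∞} (hq : 1 ≤ q) (hg : MemLp g q μ) (n : ℕ) :
    lpNorm (birkhoffSum T g n) q μ ≤ n * lpNorm g q μ := by
  have : birkhoffSum T g n = ∑ k ∈ Finset.range n, g ∘ T^[k] := by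
    ext x; simp [birkhoffSum]
  rw [this]
  refine (lpNorm_sum_le (fun k _ => hg.comp_measurePreserving (hT.iterate k)) hq).trans ?_
  simp [lpNorm_comp (hT.iterate _) hg.1]

/-- A Burkholder-type inequality with constant of order `√p` for stationary reversed martingale
differences. -/
lemma lpNorm_birkhoffSum_sq_le [MeasurableSpace M] {μ : Measure M} [IsProbabilityMeasure μ]
    {T : M → M} (hT : MeasurePreserving T μ μ) {d : M → ℝ} (hd : MemLp d ∞ μ) {p : ℝ} (hp : 2 < p)
    (horth : ∀ k, ∫ x, |birkhoffSum T d k (T x)| ^ (p - 2) * birkhoffSum T d k (T x) * d x ∂μ = 0)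
    (n : ℕ) :
    lpNorm (birkhoffSum T d n) (ENNReal.ofReal p) μ ^ 2 ≤
      6 * p * n * lpNorm d (ENNReal.ofReal p) μ ^ 2 := by
  have hp0 : 0 < p := by linarith
  have hp1 : 1 ≤ ENNReal.ofReal p := by
    rw [← ENNReal.ofReal_one]; exact ENNReal.ofReal_le_ofReal (by linarith)
  have hS : ∀ k, MemLp (birkhoffSum T d k) ∞ μ := memLp_birkhoffSum hT hd
  have hST : ∀ k, MemLp (fun x => birkhoffSum T d k (T x)) ∞ μ :=
    fun k => (hS k).comp_measurePreserving hT
  have hcomp : ∀ k, lpNorm (fun x => birkhoffSum T d k (T x)) (ENNReal.ofReal p) μ =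
      lpNorm (birkhoffSum T d k) (ENNReal.ofReal p) μ := fun k => lpNorm_comp hT (hS k).1 _
  have cpow : ∀ s : ℝ, 0 ≤ s → Continuous fun t : ℝ => |t| ^ s := fun s hs =>
    continuous_abs.rpow_const fun _ => Or.inr hs
  induction n with
  | zero => simp
  | succ k ih =>
    push_cast
    refine sq_le_of_moment_recursion hp lpNorm_nonneg lpNorm_nonneg ?_ ih ?_
    · set A := fun x => birkhoffSum T d k (T x)
      -- The first summand is split off, not the last: time is reversed, and the remaining sum `A`
      -- is the one that `horth` makes orthogonal to `d`. This removes the linear Taylor term.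
      have hB : ∀ x, birkhoffSum T d (k + 1) x = A x + d x := fun x => by
        rw [birkhoffSum_succ', add_comm]
      have hsq : MemLp (fun x => d x ^ 2) ∞ μ := memLp_top_continuous_comp hd (continuous_pow 2)
      have i1 : Integrable (fun x => |A x| ^ p) μ :=
        integrable_of_memLp_top (memLp_top_continuous_comp (hST k) (cpow p hp0.le))
      have i2 : Integrable (fun x => |A x| ^ (p - 2) * A x * d x) μ :=
        integrable_of_memLp_top (memLp_top_mul (memLp_top_continuous_comp (hST k)
          ((cpow (p - 2) (by linarith)).mul continuous_id)) hd)
      have i3 : Integrable (fun x => |A x| ^ (p - 2) * d x ^ 2) μ :=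
        integrable_of_memLp_top (memLp_top_mul (memLp_top_continuous_comp (hST k)
          (cpow (p - 2) (by linarith))) hsq)
      have i4 : Integrable (fun x => |birkhoffSum T d (k + 1) x| ^ (p - 2) * d x ^ 2) μ :=
        integrable_of_memLp_top (memLp_top_mul (memLp_top_continuous_comp (hS (k + 1))
          (cpow (p - 2) (by linarith))) hsq)
      have i0 : Integrable (fun x => |birkhoffSum T d (k + 1) x| ^ p) μ :=
        integrable_of_memLp_top (memLp_top_continuous_comp (hS (k + 1)) (cpow p hp0.le))
      have i12 : Integrable (fun x => |A x| ^ p + p * (|A x| ^ (p - 2) * A x * d x)) μ :=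
        i1.add (i2.const_mul p)
      have i34 : Integrable (fun x => |A x| ^ (p - 2) * d x ^ 2 +
          |birkhoffSum T d (k + 1) x| ^ (p - 2) * d x ^ 2) μ := i3.add i4
      rw [lpNorm_rpow (hS (k + 1)).1 hp0, ← hcomp k, lpNorm_rpow (hST k).1 hp0]
      calc ∫ x, |birkhoffSum T d (k + 1) x| ^ p ∂μ
          ≤ ∫ x, (|A x| ^ p + p * (|A x| ^ (p - 2) * A x * d x) + p ^ 2 *
              (|A x| ^ (p - 2) * d x ^ 2 +
                |birkhoffSum T d (k + 1) x| ^ (p - 2) * d x ^ 2)) ∂μ := by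
            refine integral_mono i0 (i12.add (i34.const_mul _)) fun x => ?_
            have := abs_rpow_le_taylor hp (A x) (d x)
            simpa only [hB] using this
        _ = ∫ x, |A x| ^ p ∂μ + p ^ 2 * (∫ x, |A x| ^ (p - 2) * d x ^ 2 ∂μ +
              ∫ x, |birkhoffSum T d (k + 1) x| ^ (p - 2) * d x ^ 2 ∂μ) := by
            rw [integral_add i12 (i34.const_mul _),
              integral_add i1 (i2.const_mul p), integral_const_mul, integral_const_mul,
              integral_add i3 i4, horth k]
            ring
        _ ≤ _ := by
            gcongr
            · exact integral_rpow_mul_sq_le (hST k) hd hp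
            · exact integral_rpow_mul_sq_le (hS (k + 1)) hd hp
    · have := lpNorm_birkhoffSum_le hT hp1 (hd.mono_exponent le_top) (k + 1)
      push_cast at this
      exact this

lemma integral_mul_eq_zero_of_condExp {m : MeasurableSpace M} [m0 : MeasurableSpace M]
    {μ : Measure M} [IsProbabilityMeasure μ] (hm : m ≤ m0) {g d : M → ℝ}
    (hd : MemLp d ∞ μ) (hg : MemLp g ∞ μ) (hgm : AEStronglyMeasurable[m] g μ)
    (h0 : μ[d|m] =ᵐ[μ] 0) : ∫ x, g x * d x ∂μ = 0 := by
  rw [← integral_condExp hm]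
  have h := condExp_mul_of_aestronglyMeasurable_left (m := m) (μ := μ) (f := g) (g := d) hgm
    (integrable_of_memLp_top (memLp_top_mul hg hd)) (integrable_of_memLp_top hd)
  have h2 : μ[fun x => g x * d x|m] =ᵐ[μ] 0 := by
    refine h.trans ?_
    filter_upwards [h0] with x hx
    simp [hx]
  rw [integral_congr_ae h2]; simp

lemma birkhoffSum_mul (T : M → M) (g : M → ℝ) (L n : ℕ) :
    birkhoffSum T g (L * n) = ∑ c ∈ Finset.range L, birkhoffSum T^[L] g n ∘ T^[c] := by
  induction n with
  | zero => ext x; simp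
  | succ n ih =>
    ext x
    rw [Nat.mul_succ, birkhoffSum_add, ih]
    simp only [Finset.sum_apply, Function.comp_apply, birkhoffSum_succ, Finset.sum_add_distrib]
    congr 1
    simp only [birkhoffSum, ← Function.iterate_mul, ← Function.iterate_add_apply]
    exact Finset.sum_congr rfl fun i _ => by rw [add_comm]

/-! ### The two-sided filtration and the dyadic martingale decomposition -/

/-- The iterate `fᵏ` for an integer `k`. -/
def zIter {m0 : MeasurableSpace M} (f : M ≃ᵐ M) (k : ℤ) : M → M :=
  ⇑((f.toEquiv : Equiv.Perm M) ^ k)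

/-- The σ-algebra `f⁻ᵏ ℱ` for an integer `k`. -/
abbrev shiftAlgebra {m0 : MeasurableSpace M} (f : M ≃ᵐ M) (ℱ : MeasurableSpace M) (k : ℤ) :
    MeasurableSpace M := ℱ.comap (zIter f k)

section

variable {ℱ m0 : MeasurableSpace M} {μ : Measure M} (f : M ≃ᵐ M)

lemma zIter_natCast (n : ℕ) : zIter f n = f^[n] := by
  ext x
  simp only [zIter, zpow_natCast]
  rw [Equiv.Perm.coe_pow]; rfl

lemma zIter_one : zIter f 1 = f := by
  simpa using zIter_natCast f 1

lemma zIter_add (a b : ℤ) : zIter f (a + b) = zIter f a ∘ zIter f b := by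
  simp [zIter, zpow_add]

lemma zIter_neg_natCast (n : ℕ) : zIter f (-n) = f.symm^[n] := by
  ext x
  simp only [zIter, zpow_neg, zpow_natCast, ← inv_pow]
  rw [Equiv.Perm.coe_pow]; rfl

lemma measurePreserving_zIter (hf : MeasurePreserving f μ μ) (k : ℤ) :
    MeasurePreserving (zIter f k) μ μ := by
  obtain ⟨n, rfl | rfl⟩ := k.eq_nat_or_neg
  · rw [zIter_natCast]; exact hf.iterate n
  · rw [zIter_neg_natCast]; exact (hf.symm f).iterate n

lemma measurable_zIter (k : ℤ) : Measurable (zIter f k) := by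
  obtain ⟨n, rfl | rfl⟩ := k.eq_nat_or_neg
  · rw [zIter_natCast]; exact f.measurable.iterate n
  · rw [zIter_neg_natCast]; exact f.symm.measurable.iterate n

variable {f}

lemma shiftAlgebra_le (hℱ : ℱ ≤ m0) (k : ℤ) : shiftAlgebra f ℱ k ≤ m0 :=
  (MeasurableSpace.comap_mono hℱ).trans (measurable_zIter f k).comap_le

lemma shiftAlgebra_add_natCast (k : ℤ) (n : ℕ) :
    shiftAlgebra f ℱ (k + n) = (shiftAlgebra f ℱ k).comap f^[n] := by
  rw [shiftAlgebra, zIter_add, zIter_natCast, ← MeasurableSpace.comap_comp]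

lemma antitone_shiftAlgebra (hF : ℱ.comap f ≤ ℱ) : Antitone (shiftAlgebra f ℱ) := by
  refine antitone_int_of_succ_le fun k => ?_
  rw [shiftAlgebra, add_comm, zIter_add, zIter_one, ← MeasurableSpace.comap_comp]
  exact MeasurableSpace.comap_mono hF

lemma stronglyMeasurable_comp_iterate {d : M → ℝ} {a : ℤ}
    (hd : StronglyMeasurable[shiftAlgebra f ℱ a] d) (n : ℕ) :
    StronglyMeasurable[shiftAlgebra f ℱ (a + n)] (d ∘ f^[n]) := by
  rw [shiftAlgebra_add_natCast]
  exact hd.comp_measurable (comap_measurable _)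

/-- All summands after the first are measurable for `shiftAlgebra f ℱ (a + L)`, and given that
σ-algebra `d` has conditional mean zero. This is the orthogonality that the Burkholder-type bound
requires. -/
lemma lpNorm_birkhoffSum_iterate_sq_le [IsProbabilityMeasure μ]
    (hf : MeasurePreserving f μ μ) (hℱ : ℱ ≤ m0) (hF : ℱ.comap f ≤ ℱ) {d : M → ℝ}
    (hd : MemLp d ∞ μ) {a : ℤ} (hda : StronglyMeasurable[shiftAlgebra f ℱ a] d) {L : ℕ}
    (hdL : μ[d|shiftAlgebra f ℱ (a + L)] =ᵐ[μ] 0) {p : ℝ} (hp : 2 < p) (n : ℕ) :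
    lpNorm (birkhoffSum f^[L] d n) (ENNReal.ofReal p) μ ^ 2 ≤
      6 * p * n * lpNorm d (ENNReal.ofReal p) μ ^ 2 := by
  refine lpNorm_birkhoffSum_sq_le (hf.iterate L) hd hp (fun k => ?_) n
  have hc : Continuous fun t : ℝ => |t| ^ (p - 2) * t :=
    (continuous_abs.rpow_const fun _ => Or.inr (by linarith)).mul continuous_id
  have hb : MemLp (fun x => birkhoffSum f^[L] d k (f^[L] x)) ∞ μ :=
    (memLp_birkhoffSum (hf.iterate L) hd k).comp_measurePreserving (hf.iterate L)
  have hm : StronglyMeasurable[shiftAlgebra f ℱ (a + L)]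
      (fun x => birkhoffSum f^[L] d k (f^[L] x)) := by
    simp only [birkhoffSum]
    refine Finset.stronglyMeasurable_fun_sum _ fun i _ => ?_
    have h1 := (stronglyMeasurable_comp_iterate hda (L * i + L)).mono
      (antitone_shiftAlgebra hF (show a + L ≤ a + ((L * i + L : ℕ) : ℤ) by push_cast; nlinarith))
    convert h1 using 2 with x
    rw [Function.comp_apply, Function.iterate_add_apply, Function.iterate_mul]
  exact integral_mul_eq_zero_of_condExp (shiftAlgebra_le hℱ _) hd
    (memLp_top_continuous_comp hb hc) (hc.comp_stronglyMeasurable hm).aestronglyMeasurable hdL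

lemma one_le_ofReal {p : ℝ} (hp : 1 ≤ p) : 1 ≤ ENNReal.ofReal p := by
  rw [← ENNReal.ofReal_one]; exact ENNReal.ofReal_le_ofReal hp

/-- For s ≤ m the sum splits into 2ˢ residue classes, each a martingale sum of length 2^(m-s) for
f^(2ˢ); adding their norms costs 2ˢ · √2^(m-s) = √2ˢ · √2^m. For m ≤ s the triangle inequality is
already as good. -/
lemma lpNorm_birkhoffSum_two_pow_le [IsProbabilityMeasure μ]
    (hf : MeasurePreserving f μ μ) (hℱ : ℱ ≤ m0) (hF : ℱ.comap f ≤ ℱ) {d : M → ℝ}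
    (hd : MemLp d ∞ μ) {a b : ℤ} (s m : ℕ) (hab : b = a + 2 ^ s)
    (hda : StronglyMeasurable[shiftAlgebra f ℱ a] d)
    (hdL : μ[d|shiftAlgebra f ℱ b] =ᵐ[μ] 0) {p : ℝ} (hp : 2 < p) :
    lpNorm (birkhoffSum f d (2 ^ m)) (ENNReal.ofReal p) μ ≤
      √(6 * p * 2 ^ m) * (√2 ^ s * lpNorm d (ENNReal.ofReal p) μ) := by
  subst hab
  have hp1 := one_le_ofReal (show 1 ≤ p by linarith)
  have hdp : MemLp d (ENNReal.ofReal p) μ := hd.mono_exponent le_top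
  set N := lpNorm d (ENNReal.ofReal p) μ
  have hN : 0 ≤ N := lpNorm_nonneg
  have hsq : √2 ^ s * √2 ^ s = (2 : ℝ) ^ s := by
    rw [← mul_pow, Real.mul_self_sqrt (by norm_num)]
  have hs0 : 0 ≤ √2 ^ s := by positivity
  rcases le_total s m with hsm | hsm
  · obtain ⟨n, rfl⟩ := Nat.exists_eq_add_of_le hsm
    rw [pow_add, birkhoffSum_mul, pow_add]
    have h1 : lpNorm (birkhoffSum f^[2 ^ s] d (2 ^ n)) (ENNReal.ofReal p) μ ≤
        √(6 * p * 2 ^ n) * N := by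
      have h2 := lpNorm_birkhoffSum_iterate_sq_le hf hℱ hF hd hda (L := 2 ^ s)
        (by simpa using hdL) hp (2 ^ n)
      push_cast at h2
      rw [← Real.sqrt_sq hN, ← Real.sqrt_mul (by positivity)]
      exact Real.le_sqrt_of_sq_le h2
    refine (lpNorm_sum_le (fun c _ => (memLp_birkhoffSum (hf.iterate _) hdp _).comp_measurePreserving
      (hf.iterate c)) hp1).trans ?_
    simp only [lpNorm_comp (hf.iterate _) (memLp_birkhoffSum (hf.iterate _) hdp _).1,
      Finset.sum_const, Finset.card_range, nsmul_eq_mul]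
    push_cast
    have e : √(6 * p * (2 ^ s * 2 ^ n)) = √2 ^ s * √(6 * p * 2 ^ n) := by
      rw [show 6 * p * ((2 : ℝ) ^ s * 2 ^ n) = (√2 ^ s) ^ 2 * (6 * p * 2 ^ n) by
        rw [pow_two, hsq]; ring, Real.sqrt_mul (by positivity), Real.sqrt_sq hs0]
    calc _ ≤ (2 : ℝ) ^ s * (√(6 * p * 2 ^ n) * N) := by gcongr
      _ = _ := by rw [e, ← hsq]; ring
  · refine (lpNorm_birkhoffSum_le hf hp1 hdp _).trans ?_
    push_cast
    rw [← mul_assoc]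
    refine mul_le_mul_of_nonneg_right ?_ hN
    rw [← Real.sqrt_sq hs0, ← Real.sqrt_mul (by positivity), pow_two, hsq]
    apply Real.le_sqrt_of_sq_le
    have h1 : (2 : ℝ) ^ m ≤ 2 ^ s := pow_le_pow_right₀ (by norm_num) hsm
    have h2 : (0 : ℝ) < 2 ^ m := by positivity
    calc ((2 : ℝ) ^ m) ^ 2 = 1 * 2 ^ m * 2 ^ m := by ring
      _ ≤ 6 * p * 2 ^ m * 2 ^ s := by gcongr; linarith

/-- A dyadic moment bound for Birkhoff sums, in terms of the rates at which the conditional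
expectations of `φ` along `f⁻ᵏ ℱ` tend to `0` and to `φ`. -/
lemma lpNorm_birkhoffSum_le_of_condExp [IsProbabilityMeasure μ]
    (hf : MeasurePreserving f μ μ) (hℱ : ℱ ≤ m0) (hF : ℱ.comap f ≤ ℱ) {φ : M → ℝ}
    (hφ : MemLp φ ∞ μ) {p : ℝ} (hp : 2 < p) {A : ℕ → ℝ}
    (hanti : ∀ s : ℕ, A (2 ^ (s + 1)) ≤ A (2 ^ s))
    (h1 : ∀ n : ℕ, 1 ≤ n → lpNorm (μ[φ|shiftAlgebra f ℱ n]) (ENNReal.ofReal p) μ ≤ A n)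
    (h2 : ∀ n : ℕ, 1 ≤ n → lpNorm (φ - μ[φ|shiftAlgebra f ℱ (-n)]) (ENNReal.ofReal p) μ ≤ A n)
    (hA1 : lpNorm φ (ENNReal.ofReal p) μ ≤ A 1) (m S : ℕ) :
    lpNorm (birkhoffSum f φ (2 ^ m)) (ENNReal.ofReal p) μ ≤
      2 ^ m * (2 * A (2 ^ S)) +
        √(6 * p * 2 ^ m) * (6 * A 1 + ∑ s ∈ Finset.range S, √2 ^ s * (4 * A (2 ^ s))) := by
  have hp1 := one_le_ofReal (show 1 ≤ p by linarith)
  set q := ENNReal.ofReal p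
  set η : ℤ → M → ℝ := fun k => μ[φ|shiftAlgebra f ℱ k]
  have hη : ∀ k, MemLp (η k) ∞ μ := fun k => hφ.condExp le_top
  have hηq : ∀ k, MemLp (η k) q μ := fun k => (hη k).mono_exponent le_top
  have hφq : MemLp φ q μ := hφ.mono_exponent le_top
  have hblock : ∀ (a b : ℤ) (s : ℕ), b = a + 2 ^ s →
      lpNorm (birkhoffSum f (η a - η b) (2 ^ m)) q μ ≤
        √(6 * p * 2 ^ m) * (√2 ^ s * lpNorm (η a - η b) q μ) := by
    intro a b s hab
    have hba : shiftAlgebra f ℱ b ≤ shiftAlgebra f ℱ a :=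
      antitone_shiftAlgebra hF (by rw [hab]; linarith [pow_pos (two_pos : (0 : ℤ) < 2) s])
    refine lpNorm_birkhoffSum_two_pow_le hf hℱ hF ((hη a).sub (hη b)) s m hab
      (stronglyMeasurable_condExp.sub (stronglyMeasurable_condExp.mono hba)) ?_ hp
    have e1 := condExp_sub (μ := μ) (integrable_of_memLp_top (hη a))
      (integrable_of_memLp_top (hη b)) (shiftAlgebra f ℱ b)
    have e2 : μ[η a|shiftAlgebra f ℱ b] =ᵐ[μ] η b :=
      condExp_condExp_of_le hba (shiftAlgebra_le hℱ a)
    have e3 : μ[η b|shiftAlgebra f ℱ b] =ᵐ[μ] η b :=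
      condExp_condExp_of_le le_rfl (shiftAlgebra_le hℱ b)
    filter_upwards [e1, e2, e3] with x h1 h2 h3
    rw [h1]; simp [h2, h3]
  have htri : ∀ u v : M → ℝ, MemLp u q μ →
      lpNorm (birkhoffSum f (u + v) (2 ^ m)) q μ ≤
        lpNorm (birkhoffSum f u (2 ^ m)) q μ + lpNorm (birkhoffSum f v (2 ^ m)) q μ := by
    intro u v hu
    have e : birkhoffSum f (u + v) (2 ^ m) =
        birkhoffSum f u (2 ^ m) + birkhoffSum f v (2 ^ m) := by
      ext x; exact birkhoffSum_add' f u v _ x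
    rw [e]
    exact lpNorm_add_le (memLp_birkhoffSum hf hu _) hp1
  have hd : ∀ k, MemLp (φ - η k) q μ := fun k => hφq.sub (hηq k)
  have hη1 : ∀ s : ℕ, lpNorm (η (2 ^ s)) q μ ≤ A (2 ^ s) := fun s => by
    simpa using h1 (2 ^ s) Nat.one_le_two_pow
  have hη2 : ∀ s : ℕ, lpNorm (φ - η (-2 ^ s)) q μ ≤ A (2 ^ s) := fun s => by
    simpa using h2 (2 ^ s) Nat.one_le_two_pow
  -- Each step in `S` moves both remainders one dyadic scale outward and splits off two blocks of
  -- gap 2^S. Each block has norm at most 2 A(2^S), hence the 4 in the sum.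
  have main : lpNorm (birkhoffSum f φ (2 ^ m)) q μ ≤
      lpNorm (birkhoffSum f (φ - η (-2 ^ S)) (2 ^ m)) q μ +
      lpNorm (birkhoffSum f (η (2 ^ S)) (2 ^ m)) q μ +
        √(6 * p * 2 ^ m) * (6 * A 1 + ∑ s ∈ Finset.range S, √2 ^ s * (4 * A (2 ^ s))) := by
    induction S with
    | zero =>
      have e : φ = (φ - η (-1)) + (η 1 + (η (-1) - η 1)) := by abel
      have t1 := htri (φ - η (-1)) (η 1 + (η (-1) - η 1)) (hd _)
      have t2 := htri (η 1) (η (-1) - η 1) (hηq _)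
      rw [← e] at t1
      -- The central block has gap 2 = 2¹; it contributes √2 · 3 A(1) ≤ 6 A(1).
      have t5 := hblock (-1) 1 1 (by norm_num)
      have b1 : lpNorm (η 1) q μ ≤ A 1 := by simpa using h1 1 le_rfl
      have b2 : lpNorm (φ - η (-1)) q μ ≤ A 1 := by simpa using h2 1 le_rfl
      have b3 : lpNorm (η (-1)) q μ ≤ A 1 + A 1 :=
        (lpNorm_le_lpNorm_add_lpNorm_sub hφq hp1).trans (add_le_add hA1 b2)
      have b4 : lpNorm (η (-1) - η 1) q μ ≤ 3 * A 1 :=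
        (lpNorm_sub_le (hηq _) hp1).trans (by linarith)
      have hs2 : √2 ≤ 2 := by
        rw [Real.sqrt_le_left (by norm_num)]; norm_num
      have b5 : √2 ^ 1 * lpNorm (η (-1) - η 1) q μ ≤ 6 * A 1 := by
        rw [pow_one]
        calc √2 * lpNorm (η (-1) - η 1) q μ ≤ 2 * (3 * A 1) :=
              mul_le_mul hs2 b4 lpNorm_nonneg (by norm_num)
          _ = _ := by ring
      have c3 := mul_le_mul_of_nonneg_left b5 (Real.sqrt_nonneg (6 * p * 2 ^ m))
      simp only [Finset.range_zero, Finset.sum_empty, add_zero, pow_zero]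
      linarith
    | succ S ih =>
      have t1 := htri (φ - η (-2 ^ (S + 1))) (η (-2 ^ (S + 1)) - η (-2 ^ S)) (hd _)
      have t2 := htri (η (2 ^ (S + 1))) (η (2 ^ S) - η (2 ^ (S + 1))) (hηq _)
      rw [sub_add_sub_cancel] at t1
      rw [add_sub_cancel] at t2
      have u1 := hblock (-2 ^ (S + 1)) (-2 ^ S) S (by ring)
      have u2 := hblock (2 ^ S) (2 ^ (S + 1)) S (by ring)
      have v1 : lpNorm (η (-2 ^ (S + 1)) - η (-2 ^ S)) q μ ≤ 2 * A (2 ^ S) := by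
        rw [← sub_sub_sub_cancel_left (η (-2 ^ S)) (η (-2 ^ (S + 1))) φ]
        refine (lpNorm_sub_le (hd _) hp1).trans ?_
        linarith [hη2 S, hη2 (S + 1), hanti S]
      have v2 : lpNorm (η (2 ^ S) - η (2 ^ (S + 1))) q μ ≤ 2 * A (2 ^ S) := by
        refine (lpNorm_sub_le (hηq _) hp1).trans ?_
        linarith [hη1 S, hη1 (S + 1), hanti S]
      have w : √(6 * p * 2 ^ m) * (√2 ^ S * lpNorm (η (-2 ^ (S + 1)) - η (-2 ^ S)) q μ) +
          √(6 * p * 2 ^ m) * (√2 ^ S * lpNorm (η (2 ^ S) - η (2 ^ (S + 1))) q μ) ≤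
          √(6 * p * 2 ^ m) * (√2 ^ S * (4 * A (2 ^ S))) := by
        rw [← mul_add, ← mul_add]
        gcongr
        linarith
      rw [Finset.sum_range_succ, ← add_assoc, mul_add (√(6 * p * 2 ^ m))]
      linarith
  refine main.trans (add_le_add_left ?_ _)
  have t1 := lpNorm_birkhoffSum_le hf hp1 (hd (-2 ^ S)) (2 ^ m)
  have t2 := lpNorm_birkhoffSum_le hf hp1 (hηq (2 ^ S)) (2 ^ m)
  push_cast at t1 t2
  have c1 : (2 : ℝ) ^ m * lpNorm (φ - η (-2 ^ S)) q μ ≤ 2 ^ m * A (2 ^ S) := by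
    gcongr; exact hη2 S
  have c2 : (2 : ℝ) ^ m * lpNorm (η (2 ^ S)) q μ ≤ 2 ^ m * A (2 ^ S) := by
    gcongr; exact hη1 S
  linarith

end

/-! ### From the hypotheses to conditional expectations -/

/-- Interpolation through |g|ᵖ ≤ B^(p-1) |g|. With B ≥ 1 the prefactor is at most B, uniformly in p.
-/
lemma lpNorm_le_of_eLpNorm_one_le [MeasurableSpace M] {μ : Measure M} [IsProbabilityMeasure μ]
    {g : M → ℝ} {B c p : ℝ} (hB : 1 ≤ B) (hp : 1 ≤ p) (hc : 0 ≤ c) (hg : MemLp g ∞ μ)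
    (hgB : ∀ᵐ x ∂μ, |g x| ≤ B) (h1 : eLpNorm g 1 μ ≤ ENNReal.ofReal c) :
    lpNorm g (ENNReal.ofReal p) μ ≤ B * c ^ p⁻¹ := by
  have hp0 : 0 < p := by linarith
  have hi : ∫ x, |g x| ∂μ ≤ c := by
    have := ENNReal.toReal_mono ENNReal.ofReal_ne_top h1
    rw [toReal_eLpNorm hg.1, lpNorm_one_eq_integral_norm hg.1, ENNReal.toReal_ofReal hc] at this
    exact this
  have cp : Continuous fun t : ℝ => |t| ^ p :=
    continuous_abs.rpow_const fun _ => Or.inr hp0.le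
  have h2 : ∫ x, |g x| ^ p ∂μ ≤ B ^ (p - 1) * c := by
    calc ∫ x, |g x| ^ p ∂μ ≤ ∫ x, B ^ (p - 1) * |g x| ∂μ := by
          refine integral_mono_ae (integrable_of_memLp_top (memLp_top_continuous_comp hg cp))
            ((integrable_of_memLp_top hg).abs.const_mul _) ?_
          filter_upwards [hgB] with x hx
          calc |g x| ^ p = |g x| ^ (p - 1) * |g x| ^ (1 : ℝ) := by
                rw [← Real.rpow_add_of_nonneg (abs_nonneg _) (by linarith) (by norm_num)]; ring_nf
            _ ≤ B ^ (p - 1) * |g x| := by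
                rw [Real.rpow_one]
                gcongr
      _ ≤ _ := by
          rw [integral_const_mul]
          gcongr
  have h3 : lpNorm g (ENNReal.ofReal p) μ = (∫ x, |g x| ^ p ∂μ) ^ p⁻¹ := by
    rw [← lpNorm_rpow hg.1 hp0, Real.rpow_rpow_inv lpNorm_nonneg hp0.ne']
  rw [h3]
  calc (∫ x, |g x| ^ p ∂μ) ^ p⁻¹ ≤ (B ^ p * c) ^ p⁻¹ := by
        refine Real.rpow_le_rpow (integral_nonneg fun x => by positivity) (h2.trans ?_)
          (by positivity)
        gcongr
        linarith
    _ = B * c ^ p⁻¹ := by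
        rw [Real.mul_rpow (by positivity) hc, Real.rpow_rpow_inv (by linarith) hp0.ne']

lemma integral_mul_condExp {m m0 : MeasurableSpace M} {μ : Measure M} [IsProbabilityMeasure μ]
    (hm : m ≤ m0) {g d : M → ℝ} (hd : MemLp d ∞ μ) (hg : MemLp g ∞ μ)
    (hgm : AEStronglyMeasurable[m] g μ) :
    ∫ x, g x * d x ∂μ = ∫ x, g x * (μ[d|m]) x ∂μ := by
  rw [← integral_condExp hm]
  exact integral_congr_ae (condExp_mul_of_aestronglyMeasurable_left hgm
    (integrable_of_memLp_top (memLp_top_mul hg hd)) (integrable_of_memLp_top hd))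

lemma cellAlgebra_le [m0 : MeasurableSpace M] (𝒲 : Set (Set M)) : cellAlgebra 𝒲 ≤ m0 :=
  fun _ h => h.1

/-- Duality: the sign of the conditional expectation g is measurable for f⁻ⁿF₀, hence of the form ψ
∘ fⁿ with an F₀-measurable ψ = ±1. Testing φ against it returns ∫ |g|. -/
lemma eLpNorm_condExp_le_of_corrDecay {G : MeasurableSpace M} [m0 : MeasurableSpace M] {μ : Measure M}
    [IsProbabilityMeasure μ] (f : M ≃ᵐ M) {𝒲 : Set (Set M)} {φ : M → ℝ} (hφ : MemLp φ ∞ μ)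
    (hφ_mean : ∫ x, φ x ∂μ = 0) {C : ℝ} (hC : 0 ≤ C) {r : ℕ → ℝ} (hr : ∀ n, 0 ≤ r n)
    (h : CorrDecay μ f 𝒲 φ C r) {n : ℕ} (hn : 1 ≤ n)
    (hGn : G = shiftAlgebra f (cellAlgebra 𝒲) n) :
    eLpNorm (μ[φ|G]) 1 μ ≤ ENNReal.ofReal (C * r n) := by
  classical
  have hG : G ≤ m0 := hGn ▸ shiftAlgebra_le (cellAlgebra_le 𝒲) n
  set g := μ[φ|G]
  have hgi : MemLp g ∞ μ := hφ.condExp le_top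
  have hA : MeasurableSet[G] {x | 0 ≤ g x} :=
    measurableSet_le (measurable_const) stronglyMeasurable_condExp.measurable
  obtain ⟨B, hB, hBA⟩ : ∃ B, MeasurableSet[cellAlgebra 𝒲] B ∧
      zIter f n ⁻¹' B = {x | 0 ≤ g x} := by subst hGn; exact hA
  set ψ : M → ℝ := fun x => if x ∈ B then 1 else -1 with hψ
  have hψm : Measurable[cellAlgebra 𝒲] ψ := Measurable.ite hB measurable_const measurable_const
  have hψ1 : ∀ x, ‖ψ x‖ ≤ 1 := by
    intro x; simp only [hψ]; split_ifs <;> simp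
  have hψb : MemLp ψ ∞ μ :=
    memLp_top_of_bound (hψm.mono (cellAlgebra_le 𝒲) le_rfl).aestronglyMeasurable 1
      (ae_of_all _ hψ1)
  have hψn : (eLpNorm ψ ∞ μ).toReal ≤ 1 := by
    refine ENNReal.toReal_le_of_le_ofReal zero_le_one ?_
    rw [eLpNorm_exponent_top]
    exact eLpNormEssSup_le_of_ae_bound (ae_of_all _ hψ1)
  set s : M → ℝ := fun x => ψ (f^[n] x) with hs
  have hsm : Measurable[G] s := by
    have : s = ψ ∘ zIter f n := by rw [zIter_natCast]; rfl
    rw [this, hGn]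
    exact hψm.comp (comap_measurable _)
  have hsb : MemLp s ∞ μ :=
    memLp_top_of_bound (hsm.mono hG le_rfl).aestronglyMeasurable 1
      (ae_of_all _ fun x => hψ1 _)
  have hsg : ∀ x, s x * g x = ‖g x‖ := by
    intro x
    have hx : (f^[n] x ∈ B) ↔ 0 ≤ g x := by
      rw [← zIter_natCast, ← mem_preimage, hBA]; rfl
    simp only [hs, hψ, hx, Real.norm_eq_abs]
    split_ifs with h0
    · rw [abs_of_nonneg h0, one_mul]
    · rw [abs_of_neg (not_le.1 h0), neg_one_mul]
  have h1 := h ψ hψm hψb n hn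
  have h2 : ∫ x, ‖g x‖ ∂μ = ∫ x, φ x * ψ (f^[n] x) ∂μ := by
    simp_rw [← hsg]
    rw [← integral_mul_condExp hG hφ hsb (Measurable.stronglyMeasurable hsm).aestronglyMeasurable]
    exact integral_congr_ae (ae_of_all _ fun x => mul_comm _ _)
  have h3 : ∫ x, ‖g x‖ ∂μ ≤ C * r n := by
    rw [h2]
    refine (le_abs_self _).trans ?_
    rw [corr, hφ_mean, zero_mul, sub_zero] at h1
    refine h1.trans ?_
    have : C * (eLpNorm ψ ∞ μ).toReal ≤ C * 1 := by gcongr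
    rw [mul_one] at this
    exact mul_le_mul_of_nonneg_right this (hr n)
  rw [← ofReal_lpNorm (hgi.mono_exponent le_top), lpNorm_one_eq_integral_norm hgi.1]
  exact ENNReal.ofReal_le_ofReal h3

/-- If `𝒱`-saturations are measurable for `m` up to null sets, then `φ` is close to its conditional
expectation given `m` as soon as the cells have small images on average. -/
lemma eLpNorm_sub_condExp_le_avgDiam {m m0 : MeasurableSpace M} {μ : Measure M}
    [IsProbabilityMeasure μ] (hm : m ≤ m0) {𝒱 : Set (Set M)} (hcov : ∀ x, ∃ W ∈ 𝒱, x ∈ W)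
    (hsat : ∀ A, MeasurableSet[m0] A → ∃ B, MeasurableSet[m] B ∧ saturation 𝒱 A =ᵐ[μ] B)
    {φ : M → ℝ} (hφ : Measurable φ) {K : ℝ} (hK : ∀ x, |φ x| ≤ K) :
    eLpNorm (φ - μ[φ|m]) 1 μ ≤ 2 * avgDiam μ φ 𝒱 := by
  -- The shift by `K` makes φ nonnegative, so that suprema over cells can be taken in `ℝ≥0∞`.
  set v : M → ℝ≥0∞ := fun x => ENNReal.ofReal (φ x + K) with hv
  have hvm : Measurable v := (hφ.add_const K).ennreal_ofReal
  set u : M → ℝ≥0∞ := fun x => ⨆ y ∈ cell 𝒱 x, v y with hu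
  have hφK : ∀ x, 0 ≤ φ x + K := fun x => by linarith [(abs_le.1 (hK x)).1]
  have hmem : ∀ x, x ∈ cell 𝒱 x := fun x => by
    obtain ⟨W, hW, hx⟩ := hcov x
    exact ⟨W, ⟨hW, hx⟩, hx⟩
  -- Superlevel sets of the cellwise supremum are saturations, hence `m`-measurable only up to null
  -- sets. Countably many rational levels suffice to build an `m`-measurable version `u'`.
  have hsu : ∀ q : ℝ≥0∞, {x | q < u x} = saturation 𝒱 {y | q < v y} := by
    intro q
    ext x
    simp only [hu, lt_iSup_iff, mem_ofPred_eq, saturation, cell, mem_sUnion]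
    constructor
    · rintro ⟨y, ⟨W, ⟨hW, hx⟩, hy⟩, hq⟩
      exact ⟨W, ⟨hW, y, hy, hq⟩, hx⟩
    · rintro ⟨W, ⟨hW, y, hy, hq⟩, hx⟩
      exact ⟨y, ⟨W, ⟨hW, hx⟩, hy⟩, hq⟩
  choose B hBm hB using fun q : ℚ≥0 =>
    hsat {y | ((q : NNReal) : ℝ≥0∞) < v y} (measurableSet_lt measurable_const hvm)
  set u' : M → ℝ≥0∞ := fun x => ⨆ q : ℚ≥0, (B q).indicator (fun _ => ((q : NNReal) : ℝ≥0∞)) x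
  have hu'm : Measurable[m] u' :=
    Measurable.iSup fun q => measurable_const.indicator (hBm q)
  have huu' : ∀ᵐ x ∂μ, u' x = u x := by
    have : ∀ᵐ x ∂μ, ∀ q : ℚ≥0, (x ∈ B q ↔ ((q : NNReal) : ℝ≥0∞) < u x) := by
      rw [ae_all_iff]
      intro q
      filter_upwards [(hB q).mem_iff] with x hx
      rw [← hx, ← hsu]; rfl
    filter_upwards [this] with x hx
    apply le_antisymm
    · refine iSup_le fun q => ?_
      by_cases hq : x ∈ B q
      · rw [indicator_of_mem hq]; exact ((hx q).1 hq).le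
      · rw [indicator_of_notMem hq]; exact bot_le
    · refine le_of_forall_lt fun c hc => ?_
      obtain ⟨q, hq0, hcq, hqu⟩ := ENNReal.lt_iff_exists_rat_btwn.1 hc
      lift q to ℚ≥0 using hq0
      have e : ((Real.toNNReal ((q : ℚ) : ℝ) : NNReal) : ℝ≥0∞) = ((q : NNReal) : ℝ≥0∞) := by
        congr 1
        ext
        rw [Real.coe_toNNReal _ (by positivity)]
        rfl
      rw [e] at hcq hqu
      refine hcq.trans_le (le_trans ?_ (le_iSup _ q))
      rw [indicator_of_mem ((hx q).2 hqu)]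
  set U : M → ℝ := fun x => (u' x).toReal - K
  have hUm : Measurable[m] U := hu'm.ennreal_toReal.sub_const K
  have hub : ∀ x, u x ≤ ENNReal.ofReal (K + K) := fun x => iSup₂_le fun y _ =>
    ENNReal.ofReal_le_ofReal (by linarith [(abs_le.1 (hK y)).2])
  have hK0 : ∀ x : M, 0 ≤ K + K := fun x => by linarith [(abs_nonneg _).trans (hK x)]
  have hUb : ∀ᵐ x ∂μ, ‖U x‖ ≤ K := by
    filter_upwards [huu'] with x hx
    have h1 : (u' x).toReal ≤ K + K := by
      rw [hx]; exact ENNReal.toReal_le_of_le_ofReal (hK0 x) (hub x)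
    have h2 : 0 ≤ (u' x).toReal := ENNReal.toReal_nonneg
    rw [Real.norm_eq_abs, abs_le]
    constructor <;> simp only [U] <;> linarith
  have hUL : MemLp U ∞ μ :=
    memLp_top_of_bound (hUm.mono hm le_rfl).aestronglyMeasurable K hUb
  have hφL : MemLp φ ∞ μ := memLp_top_of_bound hφ.aestronglyMeasurable K (ae_of_all _ hK)
  have hdiam : ∀ᵐ x ∂μ, ‖(φ - U) x‖ₑ ≤ Metric.ediam (φ '' cell 𝒱 x) := by
    filter_upwards [huu'] with x hx
    have h1 : v x ≤ u x := le_iSup₂_of_le x (hmem x) le_rfl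
    have h2 : u x ≤ v x + Metric.ediam (φ '' cell 𝒱 x) := by
      refine iSup₂_le fun y hy => ?_
      have h3 : edist (φ y) (φ x) ≤ Metric.ediam (φ '' cell 𝒱 x) :=
        Metric.edist_le_ediam_of_mem (mem_image_of_mem _ hy) (mem_image_of_mem _ (hmem x))
      rw [edist_dist, Real.dist_eq] at h3
      calc v y ≤ ENNReal.ofReal ((φ x + K) + |φ y - φ x|) :=
            ENNReal.ofReal_le_ofReal (by linarith [le_abs_self (φ y - φ x)])
        _ ≤ v x + ENNReal.ofReal |φ y - φ x| := ENNReal.ofReal_add_le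
        _ ≤ _ := by gcongr
    have hut : u x ≠ ∞ := ((hub x).trans_lt ENNReal.ofReal_lt_top).ne
    have h4 : φ x + K ≤ (u x).toReal := (ENNReal.ofReal_le_iff_le_toReal hut).1 h1
    have e1 : (φ - U) x = -((u x).toReal - (φ x + K)) := by
      simp only [Pi.sub_apply, U, hx]; ring
    rw [e1, enorm_neg, Real.enorm_of_nonneg (by linarith), ENNReal.ofReal_sub _ (hφK x),
      ENNReal.ofReal_toReal hut]
    exact tsub_le_iff_left.2 h2
  have hd1 : eLpNorm (φ - U) 1 μ ≤ avgDiam μ φ 𝒱 := by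
    rw [eLpNorm_one_eq_lintegral_enorm]
    exact lintegral_mono_ae hdiam
  have hUi : Integrable U μ := integrable_of_memLp_top hUL
  have hφi : Integrable φ μ := integrable_of_memLp_top hφL
  -- As `U` is `m`-measurable, the error for φ equals the error for φ - U; the contraction property
  -- of conditional expectation then gives the factor 2.
  have hce : φ - μ[φ|m] =ᵐ[μ] (φ - U) - μ[φ - U|m] := by
    have e1 := condExp_sub hφi hUi m
    have e2 : μ[U|m] = U := condExp_of_stronglyMeasurable hm hUm.stronglyMeasurable hUi
    filter_upwards [e1] with x hx
    simp only [Pi.sub_apply] at hx ⊢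
    rw [hx, e2]; ring
  rw [eLpNorm_congr_ae hce, two_mul]
  refine (eLpNorm_sub_le (hφi.sub hUi).1 integrable_condExp.1 le_rfl).trans ?_
  exact add_le_add hd1 ((eLpNorm_condExp_le_eLpNorm _ le_rfl).trans hd1)

lemma eLpNorm_sub_condExp_le_of_cellDecay [m0 : MeasurableSpace M] {μ : Measure M}
    [IsProbabilityMeasure μ] {f : M ≃ᵐ M} (hf : MeasurePreserving f μ μ) {𝒲 : Set (Set M)}
    (h𝒲 : IsMeasurablePartition μ 𝒲) {φ : M → ℝ} (hφ : Measurable φ) {K : ℝ}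
    (hK : ∀ x, |φ x| ≤ K) {C : ℝ} {r : ℕ → ℝ} (h : CellDecay μ f 𝒲 φ C r) {n : ℕ} (hn : 1 ≤ n) :
    eLpNorm (φ - μ[φ|shiftAlgebra f (cellAlgebra 𝒲) (-n)]) 1 μ ≤
      2 * ENNReal.ofReal (C * r n) := by
  have hl : ∀ x, zIter f (-n) (f^[n] x) = x := fun x => by
    rw [zIter_neg_natCast]
    exact (Function.LeftInverse.iterate f.left_inv n) x
  have hr : ∀ x, f^[n] (zIter f (-n) x) = x := fun x => by
    rw [zIter_neg_natCast]
    exact (Function.LeftInverse.iterate f.right_inv n) x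
  refine (eLpNorm_sub_condExp_le_avgDiam (𝒱 := iterPartition f n 𝒲)
    (shiftAlgebra_le (cellAlgebra_le 𝒲) _)
    ((iterPartition_spec f n h𝒲.isPartition h𝒲.measurableSet).1.2 · |>.exists) ?_ hφ hK).trans
    (by gcongr; exact h n hn)
  intro A hA
  obtain ⟨B, hB, hAB⟩ := h𝒲.saturation_ae (f^[n] ⁻¹' A) ((f.measurable.iterate n) hA)
  refine ⟨zIter f (-n) ⁻¹' B, ⟨B, hB, rfl⟩, ?_⟩
  -- Saturation commutes with the bijection fⁿ, so the property assumed for 𝒲 passes to fⁿ𝒲.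
  have e : saturation (iterPartition f n 𝒲) A =
      zIter f (-n) ⁻¹' saturation 𝒲 (f^[n] ⁻¹' A) := by
    ext x
    simp only [saturation, iterPartition, mem_sUnion, mem_ofPred_eq, mem_preimage]
    constructor
    · rintro ⟨_, ⟨⟨W, hW, rfl⟩, _, ⟨y, hy, rfl⟩, hyA⟩, z, hz, rfl⟩
      exact ⟨W, ⟨hW, y, hy, hyA⟩, by rwa [hl]⟩
    · rintro ⟨W, ⟨hW, y, hy, hyA⟩, hx⟩
      exact ⟨f^[n] '' W, ⟨⟨W, hW, rfl⟩, _, mem_image_of_mem _ hy, hyA⟩, _, hx, hr x⟩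
  rw [e]
  exact (measurePreserving_zIter f hf (-n)).quasiMeasurePreserving.preimage_ae_eq hAB

/-- Allows φ to be truncated at its essential bound without losing the cell hypothesis, which sees
the values of φ on null sets too. -/
lemma avgDiam_comp_le [MeasurableSpace M] (μ : Measure M) (φ : M → ℝ) (𝒱 : Set (Set M))
    {c : ℝ → ℝ} (hc : LipschitzWith 1 c) : avgDiam μ (c ∘ φ) 𝒱 ≤ avgDiam μ φ 𝒱 := by
  refine lintegral_mono fun x => ?_
  rw [image_comp]
  simpa using hc.ediam_image_le (φ '' cell 𝒱 x)

/-! ### Maximal function and union bound -/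

/-- A dyadic majorant of `max_{k ≤ 2ᵐ} |S_k φ|`. -/
def dyadicMax (f : M → M) (φ : M → ℝ) : ℕ → M → ℝ
  | 0 => fun x => |φ x|
  | m + 1 => fun x => |birkhoffSum f φ (2 ^ m) x| +
      max (dyadicMax f φ m x) (dyadicMax f φ m (f^[2 ^ m] x))

lemma abs_birkhoffSum_le_dyadicMax (f : M → M) (φ : M → ℝ) (m : ℕ) (x : M) {k : ℕ}
    (hk : k ≤ 2 ^ m) : |birkhoffSum f φ k x| ≤ dyadicMax f φ m x := by
  induction m generalizing x k with
  | zero =>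
    have : k = 0 ∨ k = 1 := by rw [pow_zero] at hk; omega
    rcases this with rfl | rfl <;> simp [dyadicMax]
  | succ m ih =>
    rcases le_total k (2 ^ m) with h | h
    · exact (ih x h).trans ((le_max_left _ _).trans (le_add_of_nonneg_left (abs_nonneg _)))
    · obtain ⟨j, rfl⟩ := Nat.exists_eq_add_of_le h
      rw [birkhoffSum_add]
      refine (abs_add_le _ _).trans (add_le_add le_rfl ?_)
      exact (ih _ (by rw [pow_succ] at hk; omega)).trans (le_max_right _ _)

section

variable [MeasurableSpace M] {μ : Measure M} {f : M → M}

/-- The p-th power of a maximum is at most the sum of the p-th powers, so the loss is 2^(1/p)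
instead of 2. This keeps the maximal recursion below the growth rate of the sums. -/
lemma lpNorm_max_comp_le [IsProbabilityMeasure μ] {T : M → M} (hT : MeasurePreserving T μ μ) {g : M → ℝ}
    (hg : MemLp g ∞ μ) {p : ℝ} (hp : 1 ≤ p) :
    lpNorm (fun x => max (g x) (g (T x))) (ENNReal.ofReal p) μ ≤
      2 ^ p⁻¹ * lpNorm g (ENNReal.ofReal p) μ := by
  have hp0 : 0 < p := by linarith
  have hgT : MemLp (fun x => g (T x)) ∞ μ := hg.comp_measurePreserving hT
  have hmax : MemLp (fun x => max (g x) (g (T x))) ∞ μ := hg.sup hgT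
  have cp : Continuous fun t : ℝ => |t| ^ p :=
    continuous_abs.rpow_const fun _ => Or.inr hp0.le
  have hi : ∀ {h : M → ℝ}, MemLp h ∞ μ → Integrable (fun x => |h x| ^ p) μ := fun hh =>
    integrable_of_memLp_top (memLp_top_continuous_comp hh cp)
  have h1 : lpNorm (fun x => max (g x) (g (T x))) (ENNReal.ofReal p) μ ^ p ≤
      2 * lpNorm g (ENNReal.ofReal p) μ ^ p := by
    rw [two_mul]
    nth_rw 2 [← lpNorm_comp hT hg.1]
    rw [lpNorm_rpow hmax.1 hp0, lpNorm_rpow hg.1 hp0, lpNorm_rpow (g := g ∘ T) hgT.1 hp0,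
      ← integral_add (hi hg) (hi (h := g ∘ T) hgT)]
    refine integral_mono (hi hmax) ((hi hg).add (hi hgT)) fun x => ?_
    have a1 : 0 ≤ |g x| ^ p := by positivity
    have a2 : 0 ≤ |g (T x)| ^ p := by positivity
    rcases le_total (g x) (g (T x)) with h | h
    · simp only [max_eq_right h, Function.comp_apply]; linarith
    · simp only [max_eq_left h, Function.comp_apply]; linarith
  have h2 := Real.rpow_le_rpow (Real.rpow_nonneg lpNorm_nonneg _) h1 (inv_nonneg.2 hp0.le)
  rwa [Real.mul_rpow (by norm_num) (Real.rpow_nonneg lpNorm_nonneg _),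
    Real.rpow_rpow_inv lpNorm_nonneg hp0.ne', Real.rpow_rpow_inv lpNorm_nonneg hp0.ne'] at h2

lemma memLp_dyadicMax (hf : MeasurePreserving f μ μ) {φ : M → ℝ} (hφ : MemLp φ ∞ μ) (m : ℕ) :
    MemLp (dyadicMax f φ m) ∞ μ := by
  induction m with
  | zero => exact hφ.abs
  | succ m ih =>
    exact (memLp_birkhoffSum hf hφ _).abs.add (ih.sup (ih.comp_measurePreserving (hf.iterate _)))

/-- Moments of the maximal function are controlled by those of the dyadic Birkhoff sums. -/
lemma lpNorm_dyadicMax_le [IsProbabilityMeasure μ] (hf : MeasurePreserving f μ μ) {φ : M → ℝ} (hφ : MemLp φ ∞ μ)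
    {p A B θ : ℝ} (hp : 1 ≤ p) (hθ : 0 ≤ θ) (hB : 1 ≤ B) (hBθ : 1 + 2 ^ p⁻¹ * B ≤ θ * B)
    (hA : ∀ m : ℕ, lpNorm (birkhoffSum f φ (2 ^ m)) (ENNReal.ofReal p) μ ≤ A * θ ^ m) (m : ℕ) :
    lpNorm (dyadicMax f φ m) (ENNReal.ofReal p) μ ≤ B * A * θ ^ m := by
  have hA0 : 0 ≤ A := by simpa using lpNorm_nonneg.trans (hA 0)
  induction m with
  | zero =>
    have h := hA 0
    simp only [pow_zero, birkhoffSum_one', mul_one] at h ⊢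
    have e : lpNorm (dyadicMax f φ 0) (ENNReal.ofReal p) μ = lpNorm φ (ENNReal.ofReal p) μ :=
      lpNorm_fun_abs hφ.1 _
    rw [e]
    nlinarith
  | succ m ih =>
    have hS := memLp_birkhoffSum hf hφ (2 ^ m)
    have h1 : lpNorm (dyadicMax f φ (m + 1)) (ENNReal.ofReal p) μ ≤
        lpNorm (birkhoffSum f φ (2 ^ m)) (ENNReal.ofReal p) μ +
          2 ^ p⁻¹ * lpNorm (dyadicMax f φ m) (ENNReal.ofReal p) μ := by
      refine (lpNorm_add_le (f := fun x => |birkhoffSum f φ (2 ^ m) x|)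
        (g := fun x => max (dyadicMax f φ m x) (dyadicMax f φ m (f^[2 ^ m] x)))
        (hS.abs.mono_exponent le_top) (one_le_ofReal hp)).trans ?_
      rw [lpNorm_fun_abs hS.1]
      gcongr
      exact lpNorm_max_comp_le (hf.iterate _) (memLp_dyadicMax hf hφ m) hp
    calc _ ≤ A * θ ^ m + 2 ^ p⁻¹ * (B * A * θ ^ m) := by
          refine h1.trans (add_le_add (hA m) ?_)
          gcongr
      _ = (1 + 2 ^ p⁻¹ * B) * (A * θ ^ m) := by ring
      _ ≤ (θ * B) * (A * θ ^ m) := by gcongr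
      _ = _ := by ring

lemma measureReal_le_lpNorm_div [IsProbabilityMeasure μ] {g : M → ℝ} (hg : MemLp g ∞ μ) {p c N : ℝ} (hp : 0 < p)
    (hc : 0 < c) (hN : lpNorm g (ENNReal.ofReal p) μ ≤ N) :
    μ.real {x | c ≤ g x} ≤ (N / c) ^ p := by
  have cp : Continuous fun t : ℝ => |t| ^ p :=
    continuous_abs.rpow_const fun _ => Or.inr hp.le
  have h1 := mul_meas_ge_le_integral_of_nonneg (μ := μ) (f := fun x => |g x| ^ p)
    (ae_of_all _ fun x => by positivity)
    (integrable_of_memLp_top (memLp_top_continuous_comp hg cp)) (c ^ p)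
  rw [← lpNorm_rpow hg.1 hp] at h1
  have h2 : μ.real {x | c ≤ g x} ≤ μ.real {x | c ^ p ≤ |g x| ^ p} :=
    measureReal_mono fun x hx => Real.rpow_le_rpow hc.le (le_trans hx (le_abs_self _)) hp.le
  have hcp : 0 < c ^ p := Real.rpow_pos_of_pos hc p
  rw [Real.div_rpow (lpNorm_nonneg.trans hN) hc.le, le_div_iff₀ hcp, mul_comm]
  calc c ^ p * μ.real {x | c ≤ g x} ≤ c ^ p * μ.real {x | c ^ p ≤ |g x| ^ p} := by gcongr
    _ ≤ lpNorm g (ENNReal.ofReal p) μ ^ p := h1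
    _ ≤ N ^ p := Real.rpow_le_rpow lpNorm_nonneg hN hp.le

lemma MLD_congr (hf : MeasurePreserving f μ μ) {φ φ' : M → ℝ} (h : φ =ᵐ[μ] φ') (ε : ℝ) (n : ℕ) :
    MLD μ f φ ε n = MLD μ f φ' ε n := by
  have h1 : ∀ᵐ x ∂μ, ∀ j, φ (f^[j] x) = φ' (f^[j] x) :=
    ae_all_iff.2 fun j => (hf.iterate j).quasiMeasurePreserving.ae h
  refine measureReal_congr ?_
  filter_upwards [h1] with x hx
  have : ∀ k, birkhoffAverage ℝ f φ k x = birkhoffAverage ℝ f φ' k x := fun k => by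
    simp only [birkhoffAverage, birkhoffSum, hx]
  apply propext
  change (_ < _) ↔ (_ < _)
  simp only [this, integral_congr_ae h]

/-- Every k ≥ n lies in some dyadic range from 2^(m+i) to 2^(m+i+1); an average above ε there forces
|S_k φ| > ε 2^(m+i). -/
lemma MLD_le_tsum [IsProbabilityMeasure μ] {φ : M → ℝ} (hφ : ∫ x, φ x ∂μ = 0) {ε : ℝ} (hε : 0 < ε) {m n : ℕ} (hmn : 2 ^ m ≤ n)
    {b : ℕ → ℝ} (hb : ∀ i, μ.real {x | ε * 2 ^ (m + i) ≤ dyadicMax f φ (m + i + 1) x} ≤ b i)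
    (hs : Summable b) : MLD μ f φ ε n ≤ ∑' i, b i := by
  have hb0 : ∀ k, 0 ≤ b k := fun k => measureReal_nonneg.trans (hb k)
  have hsub : {x | ENNReal.ofReal ε < ⨆ k : ℕ, ⨆ _ : n ≤ k,
      ENNReal.ofReal |birkhoffAverage ℝ f φ k x - ∫ y, φ y ∂μ|} ⊆
      ⋃ i, {x | ε * 2 ^ (m + i) ≤ dyadicMax f φ (m + i + 1) x} := by
    intro x hx
    simp only [mem_ofPred_eq, lt_iSup_iff, hφ, sub_zero] at hx
    obtain ⟨k, hnk, hk⟩ := hx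
    have hk' := (ENNReal.ofReal_lt_ofReal_iff_of_nonneg hε.le).1 hk
    have hk0 : k ≠ 0 := by have := Nat.one_le_two_pow (n := m); omega
    have hmk : m ≤ Nat.log 2 k := Nat.le_log_of_pow_le (by norm_num) (hmn.trans hnk)
    obtain ⟨i, hi⟩ := Nat.exists_eq_add_of_le hmk
    have h1 : 2 ^ (m + i) ≤ k := hi ▸ Nat.pow_log_le_self 2 hk0
    have h2 : k ≤ 2 ^ (m + i + 1) := hi ▸ (Nat.lt_pow_succ_log_self (by norm_num) k).le
    refine mem_iUnion.2 ⟨i, le_trans ?_ (abs_birkhoffSum_le_dyadicMax f φ _ x h2)⟩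
    have hkR : (0 : ℝ) < k := by positivity
    have h3 : (2 : ℝ) ^ (m + i) ≤ k := by exact_mod_cast h1
    rw [birkhoffAverage, smul_eq_mul, abs_mul, abs_of_pos (inv_pos.2 hkR), inv_mul_eq_div,
      lt_div_iff₀ hkR] at hk'
    exact (mul_le_mul_of_nonneg_left h3 hε.le).trans hk'.le
  refine ENNReal.toReal_le_of_le_ofReal (tsum_nonneg fun i => hb0 _) ?_
  refine (measure_mono hsub).trans ((measure_iUnion_le _).trans ?_)
  rw [ENNReal.ofReal_tsum_of_nonneg (fun i => hb0 _) hs]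
  refine ENNReal.tsum_le_tsum fun i => ?_
  rw [← ofReal_measureReal]
  exact ENNReal.ofReal_le_ofReal (hb _)

end

/-! ### Moment bound uniform in the exponent -/

/-- A bounded version of `φ`, with moment bounds for its dyadic Birkhoff sums that are uniform in
the exponent. -/
lemma exists_moment_bound [MeasurableSpace M] {μ : Measure M} [IsProbabilityMeasure μ]
    {f : M ≃ᵐ M} (hf : MeasurePreserving f μ μ) {𝒲 : Set (Set M)}
    (h𝒲 : IsMeasurablePartition μ 𝒲) (hF : (cellAlgebra 𝒲).comap f ≤ cellAlgebra 𝒲)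
    {φ : M → ℝ} (hφ : Measurable φ) (hφ_bdd : MemLp φ ∞ μ) (hφ_mean : ∫ x, φ x ∂μ = 0)
    {C : ℝ} (hC : 0 < C) {r : ℕ → ℝ} (hr : ∀ n, 0 ≤ r n) (hr1 : 0 < r 1) (hr1' : r 1 ≤ 1)
    (hanti : ∀ s : ℕ, r (2 ^ (s + 1)) ≤ r (2 ^ s))
    (hcorr : CorrDecay μ f 𝒲 φ C r) (hcell : CellDecay μ f 𝒲 φ C r) :
    ∃ (φ' : M → ℝ) (D : ℝ), φ =ᵐ[μ] φ' ∧ MemLp φ' ∞ μ ∧ 0 < D ∧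
      ∀ p : ℝ, 2 < p → ∀ m S : ℕ, lpNorm (birkhoffSum f φ' (2 ^ m)) (ENNReal.ofReal p) μ ≤
        D * (2 ^ m * r (2 ^ S) ^ p⁻¹ +
          √p * √2 ^ m * (1 + ∑ s ∈ Finset.range S, √2 ^ s * r (2 ^ s) ^ p⁻¹)) := by
  set K := lpNorm φ ∞ μ with hKdef
  have hK0 : 0 ≤ K := lpNorm_nonneg
  set c : ℝ → ℝ := fun t => max (-K) (min K t) with hc
  have hcL : LipschitzWith 1 c := (LipschitzWith.id.const_min K).const_max (-K)
  set φ' : M → ℝ := c ∘ φ with hφ'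
  have hφ'm : Measurable φ' := hcL.continuous.measurable.comp hφ
  have hφ'K : ∀ x, |φ' x| ≤ K := fun x =>
    abs_le.2 ⟨le_max_left _ _, max_le (by linarith) (min_le_left _ _)⟩
  have hae : φ =ᵐ[μ] φ' := by
    filter_upwards [ae_le_lpNorm_exponent_top hφ_bdd] with x hx
    have := abs_le.1 hx
    simp only [hφ', hc, Function.comp_apply, min_eq_right this.2, max_eq_right this.1, hKdef]
  have hφ'L : MemLp φ' ∞ μ := (memLp_congr_ae hae).1 hφ_bdd
  have hmean : ∫ x, φ' x ∂μ = 0 := by rw [← integral_congr_ae hae, hφ_mean]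
  have hcorr' : CorrDecay μ f 𝒲 φ' C r := by
    intro ψ hψ hψb n hn
    have e : corr μ f φ' ψ n = corr μ f φ ψ n := by
      rw [corr, corr, hmean, hφ_mean]
      congr 2
      refine integral_congr_ae ?_
      filter_upwards [hae] with x hx
      rw [hx]
    rw [e]
    exact hcorr ψ hψ hψb n hn
  have hcell' : CellDecay μ f 𝒲 φ' C r := fun n hn =>
    (avgDiam_comp_le μ φ _ hcL).trans (hcell n hn)
  set G := shiftAlgebra f (cellAlgebra 𝒲) with hG
  have hηK : ∀ k, ∀ᵐ x ∂μ, |(μ[φ'|G k]) x| ≤ K := fun k =>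
    ae_bdd_abs_condExp_of_ae_bdd_abs (ae_of_all _ hφ'K)
  set B := 2 * K + 1
  have hB : 1 ≤ B := by simp only [B]; linarith
  -- The division by r(1) ensures D₀ r(1)^(1/p) ≥ K for every p ≥ 1, as the estimate of the central
  -- block requires; `B` bounds both η_k and φ' - η_k.
  set D₀ := B * (1 + 2 * C) / r 1 with hD₀
  have hD₀pos : 0 < D₀ := by positivity
  have hD₁ : B * (1 + 2 * C) ≤ D₀ := by
    rw [hD₀, le_div_iff₀ hr1]
    exact mul_le_of_le_one_right (by positivity) hr1'
  refine ⟨φ', 18 * D₀, hae, hφ'L, by positivity, fun p hp m S => ?_⟩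
  have hp1 : 1 ≤ p := by linarith
  have hpinv : p⁻¹ ≤ 1 := inv_le_one_of_one_le₀ hp1
  have hpinv0 : 0 ≤ p⁻¹ := by positivity
  have key : ∀ (g : M → ℝ) (n : ℕ), MemLp g ∞ μ → (∀ᵐ x ∂μ, |g x| ≤ B) →
      eLpNorm g 1 μ ≤ ENNReal.ofReal (2 * C * r n) →
      lpNorm g (ENNReal.ofReal p) μ ≤ D₀ * r n ^ p⁻¹ := by
    intro g n hg hgB h1
    refine (lpNorm_le_of_eLpNorm_one_le hB hp1 (mul_nonneg (by positivity) (hr n)) hg hgB h1).trans ?_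
    rw [Real.mul_rpow (by positivity) (hr n), ← mul_assoc]
    refine mul_le_mul_of_nonneg_right (le_trans ?_ hD₁) (Real.rpow_nonneg (hr n) _)
    refine mul_le_mul_of_nonneg_left ?_ (by linarith)
    calc (2 * C) ^ p⁻¹ ≤ (1 + 2 * C) ^ p⁻¹ := by gcongr; linarith
      _ ≤ (1 + 2 * C) ^ (1 : ℝ) := Real.rpow_le_rpow_of_exponent_le (by linarith) hpinv
      _ = _ := Real.rpow_one _
  set A : ℕ → ℝ := fun n => D₀ * r n ^ p⁻¹ with hA
  have hmain := lpNorm_birkhoffSum_le_of_condExp hf (cellAlgebra_le 𝒲) hF hφ'L hp (A := A)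
    (fun s => mul_le_mul_of_nonneg_left (Real.rpow_le_rpow (hr _) (hanti s) hpinv0) hD₀pos.le)
    (fun n hn => by
      refine key _ n (hφ'L.condExp le_top) ?_
        ((eLpNorm_condExp_le_of_corrDecay f hφ'L hmean hC.le hr hcorr' hn rfl).trans
          (ENNReal.ofReal_le_ofReal ?_))
      · filter_upwards [hηK n] with x hx
        simp only [B]; linarith
      · nlinarith [mul_nonneg hC.le (hr n)])
    (fun n hn => by
      refine key _ n (hφ'L.sub (hφ'L.condExp le_top)) ?_
        ((eLpNorm_sub_condExp_le_of_cellDecay hf h𝒲 hφ'm hφ'K hcell' hn).trans (le_of_eq ?_))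
      · filter_upwards [hηK (-n)] with x hx
        refine (abs_sub _ _).trans ?_
        have := hφ'K x
        simp only [B]; linarith
      · rw [mul_assoc 2 C, ENNReal.ofReal_mul (by norm_num : (0 : ℝ) ≤ 2)]; norm_num)
    (by
      have h1 : lpNorm φ' (ENNReal.ofReal p) μ ≤ K := by
        rw [← toReal_eLpNorm hφ'L.1]
        refine ENNReal.toReal_le_of_le_ofReal hK0
          ((eLpNorm_le_of_ae_bound (ae_of_all _ hφ'K)).trans ?_)
        simp
      have h2 : D₀ * r 1 ≤ D₀ * r 1 ^ p⁻¹ := by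
        refine mul_le_mul_of_nonneg_left ?_ hD₀pos.le
        simpa using Real.rpow_le_rpow_of_exponent_ge hr1 hr1' hpinv
      have h3 : D₀ * r 1 = B * (1 + 2 * C) := by rw [hD₀, div_mul_cancel₀ _ hr1.ne']
      have h4 : B * 1 ≤ B * (1 + 2 * C) := by gcongr; linarith
      simp only [hA, B] at *
      linarith) m S
  have hA1 : A 1 ≤ D₀ := mul_le_of_le_one_right hD₀pos.le (Real.rpow_le_one (hr 1) hr1' hpinv0)
  have hs6 : √6 ≤ 3 := by rw [Real.sqrt_le_left (by norm_num)]; norm_num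
  have hsq : √(6 * p * 2 ^ m) = √6 * (√p * √2 ^ m) := by
    rw [mul_assoc, Real.sqrt_mul (by norm_num), Real.sqrt_mul (by linarith)]
    congr 2
    have : (2 : ℝ) ^ m = (√2 ^ m) ^ 2 := by
      rw [← pow_mul, mul_comm, pow_mul, Real.sq_sqrt (by norm_num)]
    rw [this, Real.sqrt_sq (by positivity)]
  refine hmain.trans ?_
  have hsum : ∑ s ∈ Finset.range S, √2 ^ s * (4 * A (2 ^ s)) =
      4 * D₀ * ∑ s ∈ Finset.range S, √2 ^ s * r (2 ^ s) ^ p⁻¹ := by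
    rw [Finset.mul_sum]
    exact Finset.sum_congr rfl fun s _ => by simp only [hA]; ring
  set R := ∑ s ∈ Finset.range S, √2 ^ s * r (2 ^ s) ^ p⁻¹
  have hR : 0 ≤ R := Finset.sum_nonneg fun s _ =>
    mul_nonneg (by positivity) (Real.rpow_nonneg (hr _) _)
  rw [hsum, hsq, mul_add (18 * D₀)]
  refine add_le_add ?_ ?_
  · have : 0 ≤ 2 ^ m * (D₀ * r (2 ^ S) ^ p⁻¹) :=
      mul_nonneg (by positivity) (mul_nonneg hD₀pos.le (Real.rpow_nonneg (hr _) _))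
    simp only [hA]
    linarith
  · calc √6 * (√p * √2 ^ m) * (6 * A 1 + 4 * D₀ * R)
        ≤ 3 * (√p * √2 ^ m) * (6 * D₀ + 6 * D₀ * R) := by
          gcongr
          norm_num
      _ = _ := by ring

/-! ### Geometric sums -/

lemma geom_sum_le_div {y : ℝ} (hy : 1 < y) (n : ℕ) :
    ∑ s ∈ Finset.range n, y ^ s ≤ y ^ n / (y - 1) := by
  rw [geom_sum_eq hy.ne']
  have : 0 < y - 1 := by linarith
  gcongr
  linarith

lemma geom_sum_inv_le {y : ℝ} (hy : 1 < y) (n : ℕ) :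
    ∑ s ∈ Finset.range n, y⁻¹ ^ s ≤ y / (y - 1) := by
  have h1 : y⁻¹ < 1 := inv_lt_one_of_one_lt₀ hy
  have h0 : 0 ≤ y⁻¹ := by positivity
  have h2 : (1 - y⁻¹)⁻¹ = y / (y - 1) := by
    have : y - 1 ≠ 0 := by linarith
    have : y ≠ 0 := by linarith
    rw [show 1 - y⁻¹ = (y - 1) / y by field_simp, inv_div]
  rw [← h2, ← tsum_geometric_of_lt_one h0 h1]
  exact (summable_geometric_of_lt_one h0 h1).sum_le_tsum _ fun i _ => by positivity

lemma sqrt_two_bounds : 1.4 ≤ √2 ∧ √2 ≤ 1.5 := by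
  constructor
  · apply Real.le_sqrt_of_sq_le; norm_num
  · rw [Real.sqrt_le_left (by norm_num)]; norm_num

lemma sqrt_two_pow_sq (m : ℕ) : (√2 ^ m) ^ 2 = 2 ^ m := by
  rw [← pow_mul, mul_comm, pow_mul, Real.sq_sqrt (by norm_num)]

/-- A sum of terms bounded both by a growing and by a decaying geometric progression. -/
lemma sum_le_sqrt_of_two_sided {t : ℕ → ℝ} {Q : ℝ} (hQ : 1 ≤ Q) (ht0 : ∀ s, 0 ≤ t s)
    (ht1 : ∀ s, t s ≤ √2 ^ s) (ht2 : ∀ s, t s ≤ Q * (√2)⁻¹ ^ s) (S : ℕ) :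
    ∑ s ∈ Finset.range S, t s ≤ 9 * √Q := by
  obtain ⟨h14, h15⟩ := sqrt_two_bounds
  have h1 : 1 < √2 := by linarith
  -- The crossover index: √2ˢ and Q √2⁻ˢ meet where 2ˢ ≈ Q, at height √Q.
  obtain ⟨J, hJ1, hJ2⟩ := exists_nat_pow_near hQ (one_lt_two (α := ℝ))
  have hQ0 : 0 < √Q := Real.sqrt_pos.2 (by linarith)
  have hQQ : √Q * √Q = Q := Real.mul_self_sqrt (by linarith)
  have a1 : √2 ^ J ≤ √Q := by
    apply Real.le_sqrt_of_sq_le; rw [sqrt_two_pow_sq]; exact hJ1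
  have a2 : √Q ≤ √2 ^ (J + 1) := by
    rw [Real.sqrt_le_left (by positivity), sqrt_two_pow_sq]; exact hJ2.le
  have c1 : ∑ s ∈ Finset.range J, t s ≤ 3 * √Q := by
    calc ∑ s ∈ Finset.range J, t s ≤ ∑ s ∈ Finset.range J, √2 ^ s :=
          Finset.sum_le_sum fun s _ => ht1 s
      _ ≤ √2 ^ J / (√2 - 1) := geom_sum_le_div h1 J
      _ ≤ 3 * √Q := by
          rw [div_le_iff₀ (by linarith)]
          nlinarith
  have c2 : ∑ s ∈ Finset.range S, t (J + s) ≤ 6 * √Q := by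
    have e : Q * (√2)⁻¹ ^ J ≤ 1.5 * √Q := by
      rw [inv_pow, ← div_eq_mul_inv, div_le_iff₀ (by positivity)]
      calc Q = √Q * √Q := hQQ.symm
        _ ≤ √Q * √2 ^ (J + 1) := by gcongr
        _ = √2 * (√Q * √2 ^ J) := by ring
        _ ≤ 1.5 * (√Q * √2 ^ J) := by gcongr
        _ = _ := by ring
    calc ∑ s ∈ Finset.range S, t (J + s) ≤
          ∑ s ∈ Finset.range S, Q * (√2)⁻¹ ^ J * (√2)⁻¹ ^ s :=
          Finset.sum_le_sum fun s _ => by rw [mul_assoc, ← pow_add]; exact ht2 _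
      _ = Q * (√2)⁻¹ ^ J * ∑ s ∈ Finset.range S, (√2)⁻¹ ^ s := by rw [Finset.mul_sum]
      _ ≤ (1.5 * √Q) * 4 := by
          refine mul_le_mul e ((geom_sum_inv_le h1 S).trans ?_)
            (Finset.sum_nonneg fun _ _ => by positivity) (by positivity)
          rw [div_le_iff₀ (by linarith)]; linarith
      _ = 6 * √Q := by ring
  calc ∑ s ∈ Finset.range S, t s ≤ ∑ s ∈ Finset.range (J + S), t s :=
        Finset.sum_le_sum_of_subset_of_nonneg (Finset.range_mono (by omega)) fun s _ _ => ht0 s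
    _ = ∑ s ∈ Finset.range J, t s + ∑ s ∈ Finset.range S, t (J + s) := Finset.sum_range_add _ _ _
    _ ≤ 9 * √Q := by linarith

lemma exists_two_pow_near {n : ℕ} (hn : 1 ≤ n) : ∃ m : ℕ, 2 ^ m ≤ n ∧ (n : ℝ) ≤ 2 ^ (m + 1) :=
  ⟨Nat.log 2 n, Nat.pow_log_le_self 2 (by omega),
    by exact_mod_cast (Nat.lt_pow_succ_log_self (by norm_num) n).le⟩

/-! ### From moments to maximal large deviations -/

lemma MLD_le_of_poly_moments [MeasurableSpace M] {μ : Measure M} [IsProbabilityMeasure μ]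
    {f : M → M} (hf : MeasurePreserving f μ μ) {φ : M → ℝ} (hφ : MemLp φ ∞ μ)
    (hφ0 : ∫ x, φ x ∂μ = 0) {β p A : ℝ} (hβ : 0 < β) (hA : 0 < A) (hp : max 2 (2 * β) < p)
    (hS : ∀ m : ℕ, lpNorm (birkhoffSum f φ (2 ^ m)) (ENNReal.ofReal p) μ ≤
      A * (2 * 2 ^ (-β / p)) ^ m) :
    ∃ C' : ℝ, 0 < C' ∧ ∀ n : ℕ, 1 ≤ n → ∀ ε : ℝ, 0 < ε →
      MLD μ f φ ε n ≤ C' * (ε ^ (-p) * (n : ℝ) ^ (-β)) := by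
  have hp2 : 2 < p := (le_max_left _ _).trans_lt hp
  have hpβ : 2 * β < p := (le_max_right _ _).trans_lt hp
  have hp0 : 0 < p := by linarith
  set x : ℝ := 2 ^ (-β / p) with hx
  have hx0 : 0 < x := by positivity
  -- The maximal recursion closes only if 1/p < 1 - β/p, that is 1 + β < p, which follows from p > 2
  -- and p > 2β.
  have hκ : (2 : ℝ) ^ p⁻¹ < 2 * x := by
    have : 2 * x = 2 ^ (1 + -β / p) := by rw [Real.rpow_add (by norm_num), Real.rpow_one]
    rw [this]
    refine Real.rpow_lt_rpow_of_exponent_lt (by norm_num) ?_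
    rw [inv_eq_one_div, div_lt_iff₀ hp0, add_mul, div_mul_cancel₀ _ hp0.ne']
    linarith
  have hd : 0 < 2 * x - 2 ^ p⁻¹ := by linarith
  set B := max 1 (1 / (2 * x - 2 ^ p⁻¹))
  have hB1 : 1 ≤ B := le_max_left _ _
  have hBθ : 1 + 2 ^ p⁻¹ * B ≤ 2 * x * B := by
    have : 1 / (2 * x - 2 ^ p⁻¹) ≤ B := le_max_right _ _
    rw [div_le_iff₀ hd] at this
    linarith
  have hmax := lpNorm_dyadicMax_le hf hφ (p := p) (by linarith) (by positivity) hB1 hBθ hS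
  set y : ℝ := 2 ^ (-β) with hy
  have hy0 : 0 < y := by positivity
  have hy1 : y < 1 := Real.rpow_lt_one_of_one_lt_of_neg (by norm_num) (by linarith)
  have hxp : ∀ k : ℕ, (x ^ k) ^ p = y ^ k := by
    intro k
    rw [← Real.rpow_natCast, ← Real.rpow_natCast, ← Real.rpow_mul hx0.le, hx, hy,
      ← Real.rpow_mul (by norm_num), ← Real.rpow_mul (by norm_num)]
    congr 1; field_simp
  set E := (B * A * (2 * x)) ^ p with hE
  have hE0 : 0 < E := by positivity
  have h1y : 0 < 1 - y := by linarith
  refine ⟨E * (1 - y)⁻¹ * 2 ^ β, by positivity, fun n hn ε hε => ?_⟩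
  obtain ⟨m, hm1, hm2⟩ := exists_two_pow_near hn
  have hsum : Summable fun i : ℕ => E * ε ^ (-p) * y ^ m * y ^ i :=
    (summable_geometric_of_lt_one hy0.le hy1).mul_left _
  refine (MLD_le_tsum hφ0 hε hm1 (b := fun i => E * ε ^ (-p) * y ^ m * y ^ i) (fun i => ?_)
    hsum).trans ?_
  · refine (measureReal_le_lpNorm_div (memLp_dyadicMax hf hφ _) hp0 (by positivity)
      (hmax (m + i + 1))).trans (le_of_eq ?_)
    have e : B * A * (2 * x) ^ (m + i + 1) / (ε * 2 ^ (m + i)) =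
        (B * A * (2 * x)) * ε⁻¹ * x ^ (m + i) := by
      rw [pow_succ, mul_pow]; field_simp
    rw [e, Real.mul_rpow (by positivity) (by positivity),
      Real.mul_rpow (by positivity) (by positivity), hxp, Real.inv_rpow hε.le,
      ← Real.rpow_neg hε.le, pow_add, ← hE, mul_assoc]
    ring
  · rw [tsum_mul_left, tsum_geometric_of_lt_one hy0.le hy1]
    have h1 : y ^ m ≤ 2 ^ β * (n : ℝ) ^ (-β) := by
      have h2 : ((2 : ℝ) ^ (m + 1)) ^ (-β) ≤ (n : ℝ) ^ (-β) :=
        Real.rpow_le_rpow_of_nonpos (by positivity) hm2 (by linarith)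
      have h3 : ((2 : ℝ) ^ (m + 1)) ^ (-β) = y ^ m * y := by
        rw [← pow_succ, hy, ← Real.rpow_natCast, ← Real.rpow_natCast,
          ← Real.rpow_mul (by norm_num), ← Real.rpow_mul (by norm_num), mul_comm]
      have h4 : 2 ^ β * y = 1 := by
        rw [hy, ← Real.rpow_add (by norm_num)]; simp
      calc y ^ m = 2 ^ β * (y ^ m * y) := by
            rw [mul_left_comm, h4, mul_one]
        _ ≤ _ := by rw [← h3]; gcongr
    calc E * ε ^ (-p) * y ^ m * (1 - y)⁻¹
        ≤ E * ε ^ (-p) * (2 ^ β * (n : ℝ) ^ (-β)) * (1 - y)⁻¹ := by gcongr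
      _ = _ := by ring

lemma MLD_le_one [MeasurableSpace M] (μ : Measure M) [IsProbabilityMeasure μ] (f : M → M)
    (φ : M → ℝ) (ε : ℝ) (n : ℕ) : MLD μ f φ ε n ≤ 1 := measureReal_le_one

lemma MLD_le_of_exp_moments [MeasurableSpace M] {μ : Measure M} [IsProbabilityMeasure μ]
    {f : M → M} (hf : MeasurePreserving f μ μ) {φ : M → ℝ} (hφ : MemLp φ ∞ μ)
    (hφ0 : ∫ x, φ x ∂μ = 0) {ω A : ℝ} (hω : 0 < ω) (hA : 0 < A)
    (hS : ∀ p : ℝ, 4 ≤ p → ∀ m : ℕ, lpNorm (birkhoffSum f φ (2 ^ m)) (ENNReal.ofReal p) μ ≤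
      A * p ^ ω⁻¹ * √2 ^ m) :
    ∃ τ' C' : ℝ, 0 < τ' ∧ 0 < C' ∧ ∀ n : ℕ, 1 ≤ n → ∀ ε : ℝ, 0 < ε →
      MLD μ f φ ε n ≤ C' * Real.exp (-τ' * ε ^ ω * (n : ℝ) ^ (ω / 2)) := by
  obtain ⟨h14, h15⟩ := sqrt_two_bounds
  have hs0 : 0 < √2 := by linarith
  have hmax : ∀ p : ℝ, 4 ≤ p → ∀ m : ℕ, lpNorm (dyadicMax f φ m) (ENNReal.ofReal p) μ ≤
      5 * (A * p ^ ω⁻¹) * √2 ^ m := by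
    intro p hp
    refine lpNorm_dyadicMax_le hf hφ (by linarith) hs0.le (by norm_num) ?_ (hS p hp)
    -- For p ≥ 4 the constant 5 closes the recursion: 1 + 1.2 · 5 = 1.4 · 5 ≤ √2 · 5.
    have h1 : (2 : ℝ) ^ p⁻¹ ≤ 1.2 := by
      calc (2 : ℝ) ^ p⁻¹ ≤ 2 ^ (4 : ℝ)⁻¹ := by gcongr; norm_num
        _ ≤ (1.2 ^ (4 : ℝ)) ^ (4 : ℝ)⁻¹ := by gcongr; norm_num
        _ = 1.2 := Real.rpow_rpow_inv (by norm_num) (by norm_num)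
    linarith
  set A₂ := 5 * A * √2 with hA₂
  have hA₂0 : 0 < A₂ := by positivity
  -- Chosen so that for p = c z^ω the ratio in Markov's inequality is exactly e⁻¹ and the bound is
  -- e⁻ᵖ. When p < 4 the factor e⁴ makes the bound trivial.
  set c := (Real.exp 1 * A₂) ^ (-ω) with hc
  have hc0 : 0 < c := by positivity
  have hprob : ∀ ε : ℝ, 0 < ε → ∀ k : ℕ, μ.real {x | ε * 2 ^ k ≤ dyadicMax f φ (k + 1) x} ≤
      Real.exp 4 * Real.exp (-(c * (ε * √2 ^ k) ^ ω)) := by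
    intro ε hε k
    set z := ε * √2 ^ k with hz
    have hz0 : 0 < z := by positivity
    set p := c * z ^ ω with hp
    have hp0 : 0 < p := by positivity
    rcases le_total 4 p with h4 | h4
    · refine (measureReal_le_lpNorm_div (memLp_dyadicMax hf hφ _) hp0 (by positivity)
        (hmax p h4 (k + 1))).trans ?_
      have e1 : p ^ ω⁻¹ = z / (Real.exp 1 * A₂) := by
        rw [hp, Real.mul_rpow hc0.le (by positivity), Real.rpow_rpow_inv hz0.le hω.ne', hc,
          Real.rpow_neg (by positivity), Real.inv_rpow (by positivity),
          Real.rpow_rpow_inv (by positivity) hω.ne']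
        field_simp
      have e2 : 5 * (A * p ^ ω⁻¹) * √2 ^ (k + 1) / (ε * 2 ^ k) = Real.exp (-1) := by
        rw [e1, hz, hA₂, ← sqrt_two_pow_sq, Real.exp_neg, pow_succ]
        field_simp
      rw [e2, ← Real.exp_mul, ← Real.exp_add]
      exact Real.exp_le_exp.2 (by linarith)
    · refine measureReal_le_one.trans ?_
      rw [← Real.exp_add]
      exact Real.one_le_exp (by linarith)
  set ρ := √2 ^ ω with hρ
  have hρ1 : 1 < ρ := Real.one_lt_rpow (by linarith) hω
  -- By Bernoulli y ρⁱ ≥ y + i(ρ - 1) if y ≥ 1, so the doubly exponential series is dominated by a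
  -- geometric one. For y ≤ 1 the trivial bound 1 ≤ e · e⁻ʸ is used.
  set q := Real.exp (-(ρ - 1)) with hq
  have hq0 : 0 < q := Real.exp_pos _
  have hq1 : q < 1 := by simpa [hq] using hρ1
  have h1q : 0 < 1 - q := by linarith
  refine ⟨c / ρ, Real.exp 4 * (1 - q)⁻¹ + Real.exp 1, by positivity, by positivity,
    fun n hn ε hε => ?_⟩
  obtain ⟨m, hm1, hm2⟩ := exists_two_pow_near hn
  set y := c * (ε * √2 ^ m) ^ ω with hy
  have hy0 : 0 < y := by positivity
  have hyn : c / ρ * ε ^ ω * (n : ℝ) ^ (ω / 2) ≤ y := by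
    have h1 : (n : ℝ) ^ (ω / 2) ≤ ρ * (√2 ^ m) ^ ω := by
      calc (n : ℝ) ^ (ω / 2) ≤ ((2 : ℝ) ^ (m + 1)) ^ (ω / 2) := by gcongr
        _ = ((√2 ^ (m + 1)) ^ 2) ^ (ω / 2) := by rw [sqrt_two_pow_sq]
        _ = (√2 ^ (m + 1)) ^ ω := by
            rw [← Real.rpow_natCast, ← Real.rpow_mul (by positivity)]
            congr 1; push_cast; ring
        _ = _ := by rw [pow_succ, Real.mul_rpow (by positivity) (by positivity), mul_comm]
    calc c / ρ * ε ^ ω * (n : ℝ) ^ (ω / 2) ≤ c / ρ * ε ^ ω * (ρ * (√2 ^ m) ^ ω) := by gcongr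
      _ = y := by rw [hy, Real.mul_rpow hε.le (by positivity)]; field_simp
  have hmain : MLD μ f φ ε n ≤ (Real.exp 4 * (1 - q)⁻¹ + Real.exp 1) * Real.exp (-y) := by
    rcases le_total 1 y with h1 | h1
    · have hsum : Summable fun i : ℕ => Real.exp 4 * Real.exp (-y) * q ^ i :=
        (summable_geometric_of_lt_one hq0.le hq1).mul_left _
      refine (MLD_le_tsum hφ0 hε hm1 (b := fun i => Real.exp 4 * Real.exp (-y) * q ^ i)
        (fun i => ?_) hsum).trans ?_
      · refine (hprob ε hε (m + i)).trans ?_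
        rw [mul_assoc]
        gcongr
        have e1 : c * (ε * √2 ^ (m + i)) ^ ω = y * ρ ^ i := by
          rw [hy, pow_add, ← mul_assoc ε, Real.mul_rpow (by positivity) (by positivity), mul_assoc,
            hρ, Real.rpow_pow_comm hs0.le]
        rw [e1, hq, ← Real.exp_nat_mul, ← Real.exp_add]
        refine Real.exp_le_exp.2 ?_
        have h2 := one_add_mul_le_pow (a := ρ - 1) (by linarith) i
        rw [add_sub_cancel] at h2
        have h3 : 0 ≤ (i : ℝ) * (ρ - 1) := mul_nonneg i.cast_nonneg (by linarith)
        nlinarith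
      · rw [tsum_mul_left, tsum_geometric_of_lt_one hq0.le hq1]
        have : 0 < Real.exp 1 * Real.exp (-y) := by positivity
        linarith
    · refine (MLD_le_one μ f φ ε n).trans ?_
      have h2 : 1 ≤ Real.exp 1 * Real.exp (-y) := by
        rw [← Real.exp_add]; exact Real.one_le_exp (by linarith)
      have : 0 ≤ Real.exp 4 * (1 - q)⁻¹ * Real.exp (-y) := by positivity
      linarith
  refine hmain.trans ?_
  gcongr
  linarith

/-! ### Stretched exponential rates -/

/-- The exponent -1/ω turns x = τ 2^(sω)/p into a multiple of p^(1/ω) 2⁻ˢ, a geometric decay in s.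
-/
lemma exists_exp_neg_le_rpow {ω : ℝ} (hω : 0 < ω) :
    ∃ c : ℝ, 1 ≤ c ∧ ∀ x : ℝ, 0 < x → Real.exp (-x) ≤ c * x ^ (-ω⁻¹) := by
  obtain ⟨k, hk⟩ := exists_nat_gt ω⁻¹
  refine ⟨k.factorial, by exact_mod_cast Nat.factorial_pos k, fun x hx => ?_⟩
  have hf : (1 : ℝ) ≤ k.factorial := by exact_mod_cast Nat.factorial_pos k
  have hxp : 0 < x ^ ω⁻¹ := Real.rpow_pos_of_pos hx _
  rw [Real.rpow_neg hx.le, ← div_eq_mul_inv, le_div_iff₀ hxp, Real.exp_neg, inv_mul_le_iff₀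
    (Real.exp_pos x)]
  rcases le_total x 1 with h | h
  · have h1 : x ^ ω⁻¹ ≤ 1 := Real.rpow_le_one hx.le h (by positivity)
    have h2 : 1 ≤ Real.exp x := Real.one_le_exp hx.le
    nlinarith
  · calc x ^ ω⁻¹ ≤ x ^ (k : ℝ) := Real.rpow_le_rpow_of_exponent_le h hk.le
      _ = x ^ k := Real.rpow_natCast x k
      _ ≤ Real.exp x * k.factorial := by
          have := Real.pow_div_factorial_le_exp x hx.le k
          rwa [div_le_iff₀ (by positivity)] at this

/-- The dyadic sums of the `p`-th roots of a stretched exponential rate. -/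
lemma exists_sum_exp_le {τ ω : ℝ} (hτ : 0 < τ) (hω : 0 < ω) :
    ∃ c : ℝ, 0 < c ∧ ∀ p : ℝ, 1 ≤ p → ∀ S : ℕ,
      ∑ s ∈ Finset.range S, √2 ^ s * Real.exp (-τ * ((2 ^ s : ℕ) : ℝ) ^ ω) ^ p⁻¹ ≤
        c * √(p ^ ω⁻¹) := by
  obtain ⟨c, hc, hexp⟩ := exists_exp_neg_le_rpow hω
  set Q := c * max 1 (τ ^ (-ω⁻¹)) with hQ
  have hQ1 : 1 ≤ Q := by
    have : 1 ≤ max 1 (τ ^ (-ω⁻¹)) := le_max_left _ _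
    nlinarith
  refine ⟨9 * √Q, by positivity, fun p hp S => ?_⟩
  have hp0 : 0 < p := by linarith
  have hpP : 1 ≤ p ^ ω⁻¹ := Real.one_le_rpow hp (by positivity)
  rw [mul_assoc, ← Real.sqrt_mul (by linarith)]
  -- The rate is at most 1, and at most a multiple of p^(1/ω) 2⁻ˢ; the crossover yields the square
  -- root of p^(1/ω).
  refine sum_le_sqrt_of_two_sided (by nlinarith) (fun s => by positivity) (fun s => ?_)
    (fun s => ?_) S
  · refine mul_le_of_le_one_right (by positivity) (Real.rpow_le_one (by positivity) ?_ (by positivity))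
    rw [Real.exp_le_one_iff, neg_mul, neg_nonpos]
    positivity
  · have e1 : Real.exp (-τ * ((2 ^ s : ℕ) : ℝ) ^ ω) ^ p⁻¹ =
        Real.exp (-(τ * p⁻¹ * ((2 : ℝ) ^ s) ^ ω)) := by
      rw [← Real.exp_mul]; push_cast; ring_nf
    have e2 : (τ * p⁻¹ * ((2 : ℝ) ^ s) ^ ω) ^ (-ω⁻¹) =
        τ ^ (-ω⁻¹) * p ^ ω⁻¹ * (2 ^ s)⁻¹ := by
      rw [Real.mul_rpow (by positivity) (by positivity),
        Real.mul_rpow hτ.le (by positivity), Real.inv_rpow hp0.le, ← Real.rpow_neg hp0.le, neg_neg,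
        ← Real.rpow_mul (by positivity), mul_neg, mul_inv_cancel₀ hω.ne', Real.rpow_neg_one]
    have h := hexp (τ * p⁻¹ * ((2 : ℝ) ^ s) ^ ω) (by positivity)
    rw [e2] at h
    have hs : √2 ^ s * ((2 : ℝ) ^ s)⁻¹ = (√2)⁻¹ ^ s := by
      rw [← sqrt_two_pow_sq, inv_pow]
      have : √2 ^ s ≠ 0 := by positivity
      field_simp
    rw [e1]
    calc √2 ^ s * Real.exp (-(τ * p⁻¹ * ((2 : ℝ) ^ s) ^ ω))
        ≤ √2 ^ s * (c * (max 1 (τ ^ (-ω⁻¹)) * p ^ ω⁻¹ * (2 ^ s)⁻¹)) := by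
          gcongr
          refine h.trans ?_
          gcongr
          exact le_max_right _ _
      _ = Q * p ^ ω⁻¹ * (√2 ^ s * ((2 : ℝ) ^ s)⁻¹) := by rw [hQ]; ring
      _ = _ := by rw [hs]

lemma exists_exp_rpow_le {τ ω p δ : ℝ} (hτ : 0 < τ) (hω : 0 < ω) (hp : 0 < p) (hδ : 0 < δ) :
    ∃ S : ℕ, Real.exp (-τ * ((2 ^ S : ℕ) : ℝ) ^ ω) ^ p⁻¹ ≤ δ := by
  have h1 : Tendsto (fun S : ℕ => (((2 ^ S : ℕ) : ℝ)) ^ ω) atTop atTop :=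
    (tendsto_rpow_atTop hω).comp (tendsto_natCast_atTop_atTop.comp
      (tendsto_pow_atTop_atTop_of_one_lt one_lt_two))
  have h2 : Tendsto (fun S : ℕ => Real.exp (-τ * ((2 ^ S : ℕ) : ℝ) ^ ω * p⁻¹)) atTop (nhds 0) := by
    refine Real.tendsto_exp_atBot.comp ?_
    refine Tendsto.atBot_mul_const (inv_pos.2 hp) ?_
    exact h1.const_mul_atTop_of_neg (by linarith)
  obtain ⟨S, hS⟩ := (h2.eventually (eventually_le_nhds hδ)).exists
  exact ⟨S, by rwa [← Real.exp_mul]⟩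

end MaxLargeDev

/-! ### The two rates -/

open MaxLargeDev in
theorem theoremA {M : Type*} [MeasurableSpace M] (μ : Measure M) [IsProbabilityMeasure μ]
    (f : M ≃ᵐ M) (hf : Ergodic f μ)
    (𝒲 : Set (Set M)) (h𝒲 : MaxLargeDev.IsMeasurablePartition μ 𝒲)
    (hF : (MaxLargeDev.cellAlgebra 𝒲).comap f ≤ MaxLargeDev.cellAlgebra 𝒲)
    (φ : M → ℝ) (hφ : Measurable φ) (hφ_bdd : MemLp φ ∞ μ) (hφ_mean : ∫ x, φ x ∂μ = 0) :
    -- stretched exponential rates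
    (∀ τ ω C : ℝ, 0 < τ → 0 < ω → ω ≤ 1 → 0 < C →
      MaxLargeDev.CorrDecay μ f 𝒲 φ C (fun n => Real.exp (-τ * (n : ℝ) ^ ω)) →
      MaxLargeDev.CellDecay μ f 𝒲 φ C (fun n => Real.exp (-τ * (n : ℝ) ^ ω)) →
      ∃ τ' C' : ℝ, 0 < τ' ∧ 0 < C' ∧ ∀ n : ℕ, 1 ≤ n → ∀ ε : ℝ, 0 < ε →
        MaxLargeDev.MLD μ f φ ε n ≤ C' * Real.exp (-τ' * ε ^ ω * (n : ℝ) ^ (ω / 2))) ∧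
    -- polynomial rates
    (∀ β C : ℝ, 0 < β → 0 < C →
      MaxLargeDev.CorrDecay μ f 𝒲 φ C (fun n => (n : ℝ) ^ (-β)) →
      MaxLargeDev.CellDecay μ f 𝒲 φ C (fun n => (n : ℝ) ^ (-β)) →
      ∀ p : ℝ, max 2 (2 * β) < p →
      ∃ C' : ℝ, 0 < C' ∧ ∀ n : ℕ, 1 ≤ n → ∀ ε : ℝ, 0 < ε →
        MaxLargeDev.MLD μ f φ ε n ≤ C' * (ε ^ (-p) * (n : ℝ) ^ (-β))) := by
  have hmp := hf.toMeasurePreserving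
  constructor
  · intro τ ω C hτ hω hω1 hC hcorr hcell
    obtain ⟨φ', D, hae, hφ', hD, hmom⟩ := exists_moment_bound hmp h𝒲 hF hφ hφ_bdd hφ_mean hC
      (r := fun n => Real.exp (-τ * (n : ℝ) ^ ω)) (fun n => by positivity) (by positivity)
      (by rw [Real.exp_le_one_iff, neg_mul, neg_nonpos]; positivity)
      (fun s => by
        simp only [neg_mul, Real.exp_le_exp, neg_le_neg_iff]
        gcongr
        · exact one_le_two
        · omega) hcorr hcell
    obtain ⟨c, hc0, hc⟩ := exists_sum_exp_le hτ hω
    have hmean : ∫ x, φ' x ∂μ = 0 := by rw [← integral_congr_ae hae, hφ_mean]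
    obtain ⟨τ', C', h1, h2, h3⟩ := MLD_le_of_exp_moments hmp hφ' hmean hω
      (A := D * (2 + c)) (by positivity) (by
        intro p hp m
        -- The moment bound is uniform in `S`, so `S` may depend on p and m and make the remainder
        -- at most √2^m.
        obtain ⟨S, hS⟩ := exists_exp_rpow_le (p := p) (δ := (√2 ^ m)⁻¹) hτ hω (by linarith)
          (by positivity)
        refine (hmom p (by linarith) m S).trans ?_
        -- Here ω ≤ 1 enters: the Burkholder factor √p is absorbed into the square root of p^(1/ω).
        have hP : p ≤ p ^ ω⁻¹ := by
          simpa using Real.rpow_le_rpow_of_exponent_le (by linarith : 1 ≤ p)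
            ((one_le_inv₀ hω).2 hω1)
        have hP1 : 1 ≤ p ^ ω⁻¹ := by linarith
        have hsP : 1 ≤ √(p ^ ω⁻¹) := by rw [Real.one_le_sqrt]; exact hP1
        have hPP : √(p ^ ω⁻¹) * √(p ^ ω⁻¹) = p ^ ω⁻¹ := Real.mul_self_sqrt (by linarith)
        have b1 : 2 ^ m * Real.exp (-τ * ((2 ^ S : ℕ) : ℝ) ^ ω) ^ p⁻¹ ≤ p ^ ω⁻¹ * √2 ^ m := by
          calc 2 ^ m * Real.exp (-τ * ((2 ^ S : ℕ) : ℝ) ^ ω) ^ p⁻¹ ≤ 2 ^ m * (√2 ^ m)⁻¹ := by gcongr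
            _ = 1 * √2 ^ m := by rw [← sqrt_two_pow_sq]; field_simp
            _ ≤ p ^ ω⁻¹ * √2 ^ m := by gcongr
        have b2 : √p * √2 ^ m * (1 + ∑ s ∈ Finset.range S,
            √2 ^ s * Real.exp (-τ * ((2 ^ s : ℕ) : ℝ) ^ ω) ^ p⁻¹) ≤
              (1 + c) * p ^ ω⁻¹ * √2 ^ m := by
          calc _ ≤ √(p ^ ω⁻¹) * √2 ^ m * (√(p ^ ω⁻¹) + c * √(p ^ ω⁻¹)) := by
                gcongr
                exact hc p (by linarith) S
            _ = (1 + c) * (√(p ^ ω⁻¹) * √(p ^ ω⁻¹)) * √2 ^ m := by ring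
            _ = _ := by rw [hPP]
        calc _ ≤ D * (p ^ ω⁻¹ * √2 ^ m + (1 + c) * p ^ ω⁻¹ * √2 ^ m) := by gcongr
          _ = _ := by ring)
    refine ⟨τ', C', h1, h2, fun n hn ε hε => ?_⟩
    rw [MLD_congr hmp hae]
    exact h3 n hn ε hε
  · intro β C hβ hC hcorr hcell p hp
    have hp2 : 2 < p := (le_max_left _ _).trans_lt hp
    have hpβ : 2 * β < p := (le_max_right _ _).trans_lt hp
    have hp0 : 0 < p := by linarith
    obtain ⟨φ', D, hae, hφ', hD, hmom⟩ := exists_moment_bound hmp h𝒲 hF hφ hφ_bdd hφ_mean hC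
      (r := fun n => (n : ℝ) ^ (-β)) (fun n => by positivity) (by simp) (by simp)
      (fun s => by
        refine Real.rpow_le_rpow_of_nonpos (by positivity) ?_ (by linarith)
        gcongr
        · exact one_le_two
        · omega) hcorr hcell
    have hmean : ∫ x, φ' x ∂μ = 0 := by rw [← integral_congr_ae hae, hφ_mean]
    set x : ℝ := 2 ^ (-β / p) with hx
    have hx0 : 0 < x := by positivity
    have hr : ∀ s : ℕ, (((2 ^ s : ℕ) : ℝ) ^ (-β)) ^ p⁻¹ = x ^ s := by
      intro s
      push_cast
      rw [← Real.rpow_mul (by positivity), hx, ← div_eq_mul_inv, Real.rpow_pow_comm (by norm_num)]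
    -- The condition p > 2β: the dyadic sum grows geometrically, and with S = m its order 2^m x^m,
    -- once multiplied by √2^m, matches the remainder.
    have hy1 : 1 < √2 * x := by
      rw [Real.sqrt_eq_rpow, hx, ← Real.rpow_add (by norm_num)]
      refine Real.one_lt_rpow (by norm_num) ?_
      have : β / p < 1 / 2 := by rw [div_lt_div_iff₀ hp0 (by norm_num)]; linarith
      rw [neg_div]; linarith
    have hd : 0 < √2 * x - 1 := by linarith
    obtain ⟨C', h1, h2⟩ := MLD_le_of_poly_moments hmp hφ' hmean hβ (p := p)
      (A := D * (1 + √p * (1 + (√2 * x - 1)⁻¹))) (by positivity) hp (by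
        intro m
        refine (hmom p hp2 m m).trans ?_
        simp only [hr]
        have e1 : ∑ s ∈ Finset.range m, √2 ^ s * x ^ s ≤ (√2 * x) ^ m * (√2 * x - 1)⁻¹ := by
          simp_rw [← mul_pow]
          rw [← div_eq_mul_inv]
          exact geom_sum_le_div hy1 m
        have e2 : 1 ≤ (√2 * x) ^ m := one_le_pow₀ hy1.le
        calc _ ≤ D * (2 ^ m * x ^ m + √p * √2 ^ m *
              ((√2 * x) ^ m + (√2 * x) ^ m * (√2 * x - 1)⁻¹)) := by gcongr
          _ = D * (2 ^ m * x ^ m + √p * (1 + (√2 * x - 1)⁻¹) * ((√2 ^ m) ^ 2 * x ^ m)) := by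
              rw [mul_pow]; ring
          _ = _ := by rw [sqrt_two_pow_sq, mul_pow]; ring)
    refine ⟨C', h1, fun n hn ε hε => ?_⟩
    rw [MLD_congr hmp hae]
    exact h2 n hn ε hε
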